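/- **Setting.** An anonymous quantum network with $n$ parties is a connected simple undirected graph with $n$ nodes (the parties) and a port numbering: every party numbers the links incident to it. Computation is synchronous. In each round every party applies a local quantum operation to what it holds, and then one message is exchanged in each direction over every link. All parties run the same algorithm; it depends only on the globally known $n$ and $k$ and on the party's own number of ports. The round complexity is the number of rounds. The bit complexity is the number of (qu)bits sent over all links, where a link used in superposition counts with the longest message that has non-zero weight on it. Let $k\ge 2$ be an integer constant and $F_k(x_1,\dots,x_n)=\sum_{i=1}^n x_i \bmod k$. An $F_k$-algorithm $\mathcal F_k$ is such an algorithm, consisting of unitary local operations and exchanges of messages only (no intermediate measurements), after which, for every input $(x_1,\dots,x_n)\in\{0,\dots,k-1\}^n$ with party $i$ holding $|x_i\rangle$ in its input qudit and $|0\rangle$ in its output qudit, the output qudit of every party has the value $F_k(x_1,\dots,x_n)$ with certainty (the other registers may contain garbage). Let $Q^{\mathrm{rnd}}(\mathcal F_k)$ and $Q^{\mathrm{bit}}(\mathcal F_k)$ be its round complexity and its bit complexity on the network, in the worst case over all quantum states as input. **Theorem.** For every constant $k\ge 2$ there are a constant $C_k$, a finite set $\mathcal S_k$ of gates (unitary operators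 on finitely many $k$-level qudits), and an algorithm composed of gates from $\mathcal S_k$, measurements of single qudits in the computational basis, and runs, forwards or inverted, of a black-box algorithm $\mathcal F_k$, all independent of $n$, of the network and of $\mathcal F_k$, such that the following holds. For every $n$, every (unknown) network with $n$ parties and every algorithm $\mathcal F_k$ without intermediate measurements that is an $F_k$-algorithm on this network, the algorithm, run by all parties with black box $\mathcal F_k$ and without any prior shared entanglement, exactly shares the generalized GHZ state $$\frac{1}{\sqrt k}\sum_{x=0}^{k-1}|x\rangle^{\otimes n}$$ among the $n$ parties (one $k$-level qudit each), that is, the final joint state of their output qudits is this state with certainty; and it does so in at most $C_k\,Q^{\mathrm{rnd}}(\mathcal F_k)$ rounds with bit complexity at most $C_k\,Q^{\mathrm{bit}}(\mathcal F_k)$. In particular, apart from the black box $\mathcal F_k$, every party uses only a gate set of constant size for every constant $k\ge 2$. -/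

import Mathlib

open scoped Matrix Kronecker

noncomputable section

namespace AnonQ

/-! ### Networks -/

/-- A network with `n` parties: a connected simple graph together with a port numbering, that is,
for each party `v` a bijection between its ports `0, …, deg v - 1` and the links incident to it
(identified with the neighbours at their other ends). The indices `v : Fin n` only serve the
description; no algorithm below has access to them. -/
structure Network (n : ℕ) where
  graph : SimpleGraph (Fin n)
  connected : graph.Connected
  deg : Fin n → ℕ
  port : ∀ v, Fin (deg v) ≃ graph.neighborSet v

/-- The other end of the link at port `p.2` of party `p.1`: the neighbour and its port. -/
def Network.link {n : ℕ} (N : Network n) (p : Σ v, Fin (N.deg v)) : Σ v, Fin (N.deg v) :=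
  ⟨(N.port p.1 p.2).1, (N.port (N.port p.1 p.2).1).symm ⟨p.1, (N.port p.1 p.2).2.symm⟩⟩

/-- A message: a bit string of length at most `L`; the empty string means that nothing is sent. -/
abbrev Msg (L : ℕ) : Type := Σ b : Fin (L + 1), (Fin b → Bool)

/-- The number of bits of a message. -/
def Msg.len {L : ℕ} (m : Msg L) : ℕ := m.1

/-- The empty message. -/
def Msg.empty (L : ℕ) : Msg L := ⟨0, fun i => i.elim0⟩

/-! ### Algorithms without intermediate measurements

Every party holds two `k`-level qudits (number `0`: its input, number `1`: its output), a
finite-dimensional private memory, and one message register per port. -/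

/-- Basis states of the private memory and of the message registers of a party with `d` ports. -/
abbrev WorkSpace (L : ℕ) (dim : ℕ → ℕ) (d : ℕ) : Type := Fin (dim d) × (Fin d → Msg L)

instance (L : ℕ) (dim : ℕ → ℕ) (d : ℕ) : DecidableEq (WorkSpace L dim d) :=
  inferInstanceAs (DecidableEq (Fin (dim d) × (Fin d → Msg L)))

/-- An anonymous distributed quantum algorithm without intermediate measurements, on `k`-level
inputs and outputs: the algorithm run by every party, which knows nothing but its number `d` of
ports and the global information (such as the number of parties) for which the algorithm is made.
In round `t < rounds`, a party with `d` ports applies the unitary `step t d` to everything it holds,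
and then the contents of the message registers at the two ends of each link are exchanged. After
the last round, `step rounds d` is applied. -/
structure UnitaryAlgorithm (k : ℕ) [NeZero k] where
  maxLen : ℕ
  dim : ℕ → ℕ
  init : ∀ d, Fin (dim d)
  rounds : ℕ
  step : ℕ → ∀ d, Matrix.unitaryGroup ((Fin 2 → ZMod k) × WorkSpace maxLen dim d) ℂ

variable {k : ℕ} [NeZero k]

/-- The private memory and the message registers of the algorithm `F` at a party with `d` ports. -/
abbrev UnitaryAlgorithm.Work (F : UnitaryAlgorithm k) (d : ℕ) : Type := WorkSpace F.maxLen F.dim d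

/-- The initial contents of private memory and message registers. -/
def UnitaryAlgorithm.work0 (F : UnitaryAlgorithm k) (d : ℕ) : F.Work d :=
  (F.init d, fun _ => Msg.empty F.maxLen)

/-! ### Global states and their evolution

In general a party holds `q` qudits together with the work space of the algorithm `F`. -/

/-- Basis states of everything held by a party with `d` ports. -/
abbrev Local (F : UnitaryAlgorithm k) (q d : ℕ) : Type := (Fin q → ZMod k) × F.Work d

/-- Basis states of the whole network. -/
abbrev Config (F : UnitaryAlgorithm k) (q : ℕ) {n : ℕ} (N : Network n) : Type :=
  ∀ v : Fin n, Local F q (N.deg v)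

/-- (Mixed) states of the whole network, as density matrices. -/
abbrev State (F : UnitaryAlgorithm k) (q : ℕ) {n : ℕ} (N : Network n) : Type :=
  Matrix (Config F q N) (Config F q N) ℂ

/-- What all parties do simultaneously: a local operator (depending on the number of ports only),
a measurement of qudit `i` in the computational basis, or one exchange of messages. -/
inductive Action (F : UnitaryAlgorithm k) (q : ℕ) : Type
  | localOp (U : ∀ d, Matrix (Local F q d) (Local F q d) ℂ) : Action F q
  | measure (i : Fin q) : Action F q
  | exchange : Action F q

/-- Exchange of the contents of the message registers at the two ends of every link. -/
def swapMessages (F : UnitaryAlgorithm k) (q : ℕ) {n : ℕ} (N : Network n) (c : Config F q N) :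
    Config F q N :=
  fun v => ((c v).1, (c v).2.1, fun i => (c (N.link ⟨v, i⟩).1).2.2 (N.link ⟨v, i⟩).2)

/-- The effect of an action on the state of the network. A measurement turns `ρ` into the mixture
`∑ s, P s * ρ * P s` over the vectors `s` of outcomes of all parties (each party keeps its outcome
in the measured qudit). -/
def Action.apply {F : UnitaryAlgorithm k} {q n : ℕ} (N : Network n) :
    Action F q → State F q N → State F q N
  | .localOp U, ρ =>
      (Matrix.of fun c c' : Config F q N => ∏ v, U (N.deg v) (c v) (c' v)) * ρ *
        (Matrix.of fun c c' : Config F q N => ∏ v, U (N.deg v) (c v) (c' v))ᴴ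
  | .measure i, ρ => open Classical in
      Matrix.of fun c c' => if ∀ v, (c v).1 i = (c' v).1 i then ρ c c' else 0
  | .exchange, ρ => ρ.submatrix (swapMessages F q N) (swapMessages F q N)

/-- The state after a sequence of actions. -/
def run {F : UnitaryAlgorithm k} {q n : ℕ} (N : Network n) :
    List (Action F q) → State F q N → State F q N
  | [], ρ => ρ
  | a :: as, ρ => run N as (a.apply N ρ)

/-- The number of rounds of a sequence of actions, that is, of exchanges of messages. -/
def numRounds {F : UnitaryAlgorithm k} {q : ℕ} : List (Action F q) → ℕ
  | [] => 0
  | .exchange :: as => numRounds as + 1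
  | _ :: as => numRounds as

/-- The number of (qu)bits communicated when messages are exchanged in the state `ρ`: the sum over
all ports of all parties of the length of the longest message that has non-zero weight there. -/
def bitsSent {F : UnitaryAlgorithm k} {q n : ℕ} (N : Network n) (ρ : State F q N) : ℕ :=
  open Classical in
  ∑ v, ∑ i : Fin (N.deg v),
    (Finset.univ.filter fun c : Config F q N => ρ c c ≠ 0).sup fun c => ((c v).2.2 i).len

/-- The number of (qu)bits communicated during a sequence of actions started in the state `ρ`. -/
def numBits {F : UnitaryAlgorithm k} {q n : ℕ} (N : Network n) :
    List (Action F q) → State F q N → ℕ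
  | [], _ => 0
  | .exchange :: as, ρ => bitsSent N ρ + numBits N as (Action.exchange.apply N ρ)
  | a :: as, ρ => numBits N as (a.apply N ρ)

/-! ### Running an algorithm without intermediate measurements on selected qudits -/

/-- The operator that acts as `M` on the qudits selected by `e` and on the rest `W` of the local
space, and as the identity on the other qudits. -/
def lift {a q : ℕ} {W : Type} (e : Fin a ↪ Fin q)
    (M : Matrix ((Fin a → ZMod k) × W) ((Fin a → ZMod k) × W) ℂ) :
    Matrix ((Fin q → ZMod k) × W) ((Fin q → ZMod k) × W) ℂ :=
  open Classical in
  Matrix.of fun c c' =>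
    if ∀ j, j ∉ Set.range e → c.1 j = c'.1 j then M (c.1 ∘ e, c.2) (c'.1 ∘ e, c'.2) else 0

/-- The actions of the algorithm `F` with input qudit `e 0` and output qudit `e 1`. -/
def UnitaryAlgorithm.actions (F : UnitaryAlgorithm k) {q : ℕ} (e : Fin 2 ↪ Fin q) :
    List (Action F q) :=
  ((List.range F.rounds).flatMap fun t =>
      [Action.localOp fun d => lift e (F.step t d).1, Action.exchange]) ++
    [Action.localOp fun d => lift e (F.step F.rounds d).1]

/-- The inverse of an action (a measurement is not invertible and is left as it is; the actions of
an algorithm without intermediate measurements contain none). -/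
def Action.inverse {F : UnitaryAlgorithm k} {q : ℕ} : Action F q → Action F q
  | .localOp U => .localOp fun d => (U d)ᴴ
  | .measure i => .measure i
  | .exchange => .exchange

/-- The pure input state `∑ x, φ x |x⟩`, with the qudits `x v` as inputs, all outputs initialized
to `|0⟩`, and all work spaces in their initial states. -/
def UnitaryAlgorithm.inputState (F : UnitaryAlgorithm k) {n : ℕ} (N : Network n)
    (φ : (Fin n → ZMod k) → ℂ) : State F 2 N :=
  open Classical in
  let ψ : Config F 2 N → ℂ := fun c =>
    if ∀ v, (c v).1 1 = 0 ∧ (c v).2 = F.work0 (N.deg v) then φ fun v => (c v).1 0 else 0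
  Matrix.vecMulVec ψ (star ψ)

/-- The actions of the algorithm `F` run on its own input and output qudits. -/
def UnitaryAlgorithm.ownActions (F : UnitaryAlgorithm k) : List (Action F 2) :=
  F.actions (Function.Embedding.refl (Fin 2))

/-- `F` exactly computes `f` on the network `N`: on every input `x`, in the end the output of every
party is `f x` with certainty. Nothing is assumed about the other registers, which may contain
garbage depending on `x`. -/
def UnitaryAlgorithm.Computes (F : UnitaryAlgorithm k) {n : ℕ} (N : Network n)
    (f : (Fin n → ZMod k) → ZMod k) : Prop :=
  ∀ x : Fin n → ZMod k, ∀ c : Config F 2 N,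
    run N F.ownActions (F.inputState N (Pi.single x 1)) c c ≠ 0 → ∀ v, (c v).1 1 = f x

/-- The round complexity of `F` (the same for all inputs). -/
def UnitaryAlgorithm.Qrnd (F : UnitaryAlgorithm k) : ℕ := numRounds F.ownActions

/-- The bit complexity of `F` on the network `N`: the largest number of (qu)bits communicated,
over all (unit) quantum states as input. (It is bounded by `rounds * maxLen * ∑ v, deg v`.) -/
def UnitaryAlgorithm.Qbit (F : UnitaryAlgorithm k) {n : ℕ} (N : Network n) : ℕ :=
  ⨆ φ : {φ : (Fin n → ZMod k) → ℂ // ∑ x, ‖φ x‖ ^ 2 = 1},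
    numBits N F.ownActions (F.inputState N φ)

/-- The sum modulo `k` of the distributed inputs. -/
def sumMod (k n : ℕ) (x : Fin n → ZMod k) : ZMod k := ∑ v, x v

/-! ### Programs over a gate set with a black box -/

/-- A finite set of gates, that is, of unitary operators on finitely many `k`-level qudits. -/
structure GateSet (k : ℕ) [NeZero k] where
  size : ℕ
  arity : Fin size → ℕ
  gate : ∀ g, Matrix.unitaryGroup (Fin (arity g) → ZMod k) ℂ

/-- Instructions of a program with `q` local qudits, executed simultaneously by all parties: apply
a gate of the gate set to some distinct qudits, measure a qudit in the computational basis, run the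
black-box algorithm with input qudit `e 0` and output qudit `e 1`, or invert every computation
and communication of such a run. -/
inductive Instr (S : GateSet k) (q : ℕ) : Type
  | gate (g : Fin S.size) (e : Fin (S.arity g) ↪ Fin q) : Instr S q
  | measure (i : Fin q) : Instr S q
  | call (e : Fin 2 ↪ Fin q) : Instr S q
  | uncall (e : Fin 2 ↪ Fin q) : Instr S q

/-- The actions by which an instruction is carried out, if `F` is the black-box algorithm. -/
def Instr.actions {S : GateSet k} {q : ℕ} (F : UnitaryAlgorithm k) :
    Instr S q → List (Action F q)
  | .gate g e => [.localOp fun _ => lift e ((S.gate g).1 ⊗ₖ 1)]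
  | .measure i => [.measure i]
  | .call e => F.actions e
  | .uncall e => (F.actions e).reverse.map Action.inverse

/-- A program over a gate set: the same instructions for every party. In the end every party
outputs its qudit `out`. -/
structure Program (S : GateSet k) where
  qudits : ℕ
  code : List (Instr S qudits)
  out : Fin qudits

variable {S : GateSet k}

/-- The actions of the program with black box `F`. -/
def Program.actions (P : Program S) (F : UnitaryAlgorithm k) : List (Action F P.qudits) :=
  P.code.flatMap (Instr.actions F)

/-- The initial state: all qudits are `|0⟩` and all work spaces are in their initial states. -/
def Program.initState (P : Program S) (F : UnitaryAlgorithm k) {n : ℕ} (N : Network n) :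
    State F P.qudits N :=
  open Classical in
  Matrix.single (fun v => (0, F.work0 (N.deg v))) (fun v => (0, F.work0 (N.deg v))) 1

/-- The reduced state on the qudits number `i` of all parties (everything else is traced out). -/
def reduced {F : UnitaryAlgorithm k} {q n : ℕ} {N : Network n} (i : Fin q) (ρ : State F q N) :
    Matrix (Fin n → ZMod k) (Fin n → ZMod k) ℂ :=
  open Classical in
  Matrix.of fun z z' => ∑ c, ∑ c',
    if ∀ v, (c v).1 i = z v ∧ (c' v).1 i = z' v ∧ (∀ j, j ≠ i → (c v).1 j = (c' v).1 j) ∧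
        (c v).2 = (c' v).2
    then ρ c c' else 0

/-- The generalized GHZ state `(∑ x, |x⟩^{⊗ n}) / √k`. -/
def ghz (k n : ℕ) [NeZero k] : (Fin n → ZMod k) → ℂ :=
  fun z => (∑ x : ZMod k, ∏ v, if z v = x then 1 else 0) / (Real.sqrt k : ℂ)

/-- The program with black box `F`, run on the network `N`, exactly shares the generalized GHZ
state: in the end the joint state of the output qudits is the generalized GHZ state. -/
def Program.SharesGHZ (P : Program S) (F : UnitaryAlgorithm k) {n : ℕ} (N : Network n) : Prop :=
  reduced P.out (run N (P.actions F) (P.initState F N)) =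
    Matrix.vecMulVec (ghz k n) (star (ghz k n))

/-- The number of rounds of the program with black box `F`. -/
def Program.rounds (P : Program S) (F : UnitaryAlgorithm k) : ℕ := numRounds (P.actions F)

/-- The number of (qu)bits communicated by the program with black box `F` on the network `N`. -/
def Program.bits (P : Program S) (F : UnitaryAlgorithm k) {n : ℕ} (N : Network n) : ℕ :=
  numBits N (P.actions F) (P.initState F N)

end AnonQ

end

noncomputable section

namespace AnonQ

set_option linter.unusedSectionVars false

variable {k : ℕ} [NeZero k]

/-! ### Networks and messages -/

/-! Suppose that every party holds a uniformly superposed input and that the sum `s` of the inputs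
is written at every party with no garbage left. Then a local Fourier transform of the inputs turns
the uniform superposition of the vectors with sum `s` into `∑ p, ω^(p s) |p⟩^{⊗n}`, with `ω` a
primitive `k`-th root of unity (`sum_fourier_mul_sumIndicator`). This is a GHZ state up to a phase
that depends on `s`. The phase cannot simply be undone locally: the parties are indistinguishable,
so a correction made by one is made by all and acts `n` times.

The remedy is to do this twice, with sums `s` and `t`. The common values `p`, `q` then carry the
phase `ω^(p s + q t)`. Write `s = g a` and `t = g b` with `u a + v b = 1` modulo `k`. A change of
variables of determinant `1` in `(p, q)`, which depends only on `s` and `t` and so can be applied by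
every party alike, turns the phase into `ω^(g y)` for one new variable `y`
(`exists_perm_linear_form`). The other variable carries no phase, is independent of everything else
and is held by all parties: it is an exact GHZ state (`reduced_clean_constAmp`). No measurement is
needed, so vectors suffice throughout.

Garbage is removed by running `F`, adding its output to a fresh qudit and running `F` backwards
(`evolve_uncall`). Since `F` is exact, the branches with different sums have disjoint supports after
the run, distinguished by the output; fixing the copied value selects a whole branch, which the
inverse run restores. The proof works on slices, in which the qudits that `F` does not touch are
fixed. Slices also bound the communication: it depends on supports only, and every slice is a
multiple of one of at most `k` vectors whose cost is at most `F.Qbit N`. -/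

theorem Network.link_link {n : ℕ} (N : Network n) (p : Σ v, Fin (N.deg v)) :
    N.link (N.link p) = p := by
  obtain ⟨v, i⟩ := p
  -- The type of the far port depends on the neighbour, so the neighbour and the round trip through
  -- its port are generalised until equalities can be substituted.
  have key : ∀ (u : Fin n) (h : N.graph.Adj u v) (h' : N.graph.Adj v u)
      (_ : (N.port v).symm ⟨u, h'⟩ = i) (x : N.graph.neighborSet u) (_ : x = ⟨v, h⟩),
      (⟨x.1, (N.port x.1).symm ⟨u, x.2.symm⟩⟩ : Σ v, Fin (N.deg v)) = ⟨v, i⟩ := by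
    rintro u h h' rfl _ rfl
    rfl
  exact key _ (N.port v i).2.symm (N.port v i).2 ((N.port v).symm_apply_apply i) _
    ((N.port (N.port v i).1).apply_symm_apply _)

/-- The message register at port `p.2` of party `p.1`. -/
def msgAt {F : UnitaryAlgorithm k} {q n : ℕ} {N : Network n} (c : Config F q N)
    (p : Σ v, Fin (N.deg v)) : Msg F.maxLen := (c p.1).2.2 p.2

theorem msgAt_swapMessages {F : UnitaryAlgorithm k} {q n : ℕ} {N : Network n} (c : Config F q N)
    (p : Σ v, Fin (N.deg v)) : msgAt (swapMessages F q N c) p = msgAt c (N.link p) := rfl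

theorem swapMessages_swapMessages {F : UnitaryAlgorithm k} {q n : ℕ} {N : Network n}
    (c : Config F q N) : swapMessages F q N (swapMessages F q N c) = c := by
  funext v
  refine Prod.ext rfl (Prod.ext rfl (funext fun i => ?_))
  exact congrArg (msgAt c) (N.link_link ⟨v, i⟩)

/-! ### Products of local operators -/

/-- The tensor product of a family of matrices. -/
def tensor {ι : Type*} [Fintype ι] {X : ι → Type*} (M : ∀ i, Matrix (X i) (X i) ℂ) :
    Matrix (∀ i, X i) (∀ i, X i) ℂ :=
  Matrix.of fun c c' => ∏ i, M i (c i) (c' i)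

section tensor
variable {ι : Type*} [Fintype ι] [DecidableEq ι] {X : ι → Type*} [∀ i, Fintype (X i)]
  [∀ i, DecidableEq (X i)]

theorem conjTranspose_tensor (M : ∀ i, Matrix (X i) (X i) ℂ) :
    (tensor M)ᴴ = tensor fun i => (M i)ᴴ := by
  ext c c'
  simp [tensor, Matrix.conjTranspose_apply]

theorem tensor_mul (A B : ∀ i, Matrix (X i) (X i) ℂ) :
    tensor A * tensor B = tensor fun i => A i * B i := by
  ext c c'
  simp only [tensor, Matrix.mul_apply, Matrix.of_apply, Finset.prod_univ_sum,
    Fintype.piFinset_univ, Finset.prod_mul_distrib]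

theorem tensor_one : tensor (fun i => (1 : Matrix (X i) (X i) ℂ)) = 1 := by
  ext c c'
  by_cases h : c = c'
  · subst h; simp [tensor]
  · obtain ⟨i, hi⟩ := Function.ne_iff.1 h
    rw [Matrix.one_apply_ne h]
    exact Finset.prod_eq_zero (Finset.mem_univ i) (Matrix.one_apply_ne hi)

theorem conjTranspose_tensor_mul_self {M : ∀ i, Matrix (X i) (X i) ℂ}
    (h : ∀ i, (M i)ᴴ * M i = 1) : (tensor M)ᴴ * tensor M = 1 := by
  rw [conjTranspose_tensor, tensor_mul, ← tensor_one]
  simp only [h]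

end tensor

/-! ### Evolution of pure states -/

section pure
variable {F : UnitaryAlgorithm k} {q n : ℕ} (N : Network n)

/-- The effect of an action other than a measurement on vectors. -/
def Action.toLin : Action F q → (Config F q N → ℂ) →ₗ[ℂ] (Config F q N → ℂ)
  | .localOp U => (tensor fun v => U (N.deg v)).mulVecLin
  | .measure _ => LinearMap.id
  | .exchange => LinearMap.funLeft ℂ ℂ (swapMessages F q N)

/-- The action is not a measurement. -/
def Action.IsPure : Action F q → Prop
  | .measure _ => False
  | _ => True

/-- The action is a unitary operation. -/
def Action.IsUnitary : Action F q → Prop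
  | .localOp U => ∀ d, (U d)ᴴ * U d = 1
  | .measure _ => False
  | .exchange => True

/-- The effect of a sequence of actions on vectors. -/
def evolve : List (Action F q) → (Config F q N → ℂ) →ₗ[ℂ] (Config F q N → ℂ)
  | [] => LinearMap.id
  | a :: as => evolve as ∘ₗ a.toLin N

/-- The number of bits sent when messages are exchanged in the pure state `ψ`. -/
def messageBits (ψ : Config F q N → ℂ) : ℕ :=
  open Classical in
  ∑ v, ∑ i : Fin (N.deg v),
    (Finset.univ.filter fun c => ψ c ≠ 0).sup fun c => ((c v).2.2 i).len

/-- The number of bits sent during a sequence of actions started in the pure state `ψ`. -/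
def pureBits : List (Action F q) → (Config F q N → ℂ) → ℕ
  | [], _ => 0
  | .exchange :: as, ψ => messageBits N ψ + pureBits as (Action.exchange.toLin N ψ)
  | a :: as, ψ => pureBits as (a.toLin N ψ)

variable {N}

/-- Without measurements a rank-one density matrix stays rank one, which reduces the whole analysis
to vectors. -/
theorem Action.apply_vecMulVec {a : Action F q} (ha : a.IsPure) (ψ : Config F q N → ℂ) :
    a.apply N (Matrix.vecMulVec ψ (star ψ)) =
      Matrix.vecMulVec (a.toLin N ψ) (star (a.toLin N ψ)) := by
  cases a with
  | localOp U =>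
    change tensor (fun v => U (N.deg v)) * _ * (tensor fun v => U (N.deg v))ᴴ = _
    rw [Matrix.mul_vecMulVec, Matrix.vecMulVec_mul, ← Matrix.star_mulVec]
    rfl
  | measure i => exact ha.elim
  | exchange => rfl

theorem run_vecMulVec {as : List (Action F q)} (has : ∀ a ∈ as, a.IsPure)
    (ψ : Config F q N → ℂ) :
    run N as (Matrix.vecMulVec ψ (star ψ)) =
      Matrix.vecMulVec (evolve N as ψ) (star (evolve N as ψ)) := by
  induction as generalizing ψ with
  | nil => rfl
  | cons a as ih =>
    rw [List.forall_mem_cons] at has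
    rw [run, Action.apply_vecMulVec has.1, ih has.2]
    rfl

theorem bitsSent_vecMulVec (ψ : Config F q N → ℂ) :
    bitsSent N (Matrix.vecMulVec ψ (star ψ)) = messageBits N ψ := by
  refine Finset.sum_congr rfl fun v _ => Finset.sum_congr rfl fun i _ => ?_
  congr 1
  ext c
  simp only [Finset.mem_filter, Finset.mem_univ, true_and, Matrix.vecMulVec_apply, Pi.star_apply,
    ne_eq, mul_eq_zero, star_eq_zero, or_self]

theorem numBits_vecMulVec {as : List (Action F q)} (has : ∀ a ∈ as, a.IsPure)
    (ψ : Config F q N → ℂ) :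
    numBits N as (Matrix.vecMulVec ψ (star ψ)) = pureBits N as ψ := by
  induction as generalizing ψ with
  | nil => rfl
  | cons a as ih =>
    rw [List.forall_mem_cons] at has
    cases a with
    | localOp U =>
      change numBits N as ((Action.localOp U).apply N _) = _
      rw [Action.apply_vecMulVec has.1, ih has.2]
      rfl
    | measure i => exact has.1.elim
    | exchange => rw [numBits, Action.apply_vecMulVec has.1, ih has.2, bitsSent_vecMulVec]; rfl

theorem Action.IsUnitary.isPure {a : Action F q} (ha : a.IsUnitary) : a.IsPure := by
  cases a with
  | measure i => exact ha
  | localOp U => trivial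
  | exchange => trivial

theorem evolve_append (as bs : List (Action F q)) (ψ : Config F q N → ℂ) :
    evolve N (as ++ bs) ψ = evolve N bs (evolve N as ψ) := by
  induction as generalizing ψ with
  | nil => rfl
  | cons a as ih => exact ih _

theorem pureBits_append (as bs : List (Action F q)) (ψ : Config F q N → ℂ) :
    pureBits N (as ++ bs) ψ = pureBits N as ψ + pureBits N bs (evolve N as ψ) := by
  induction as generalizing ψ with
  | nil => simp [pureBits, evolve]
  | cons a as ih => cases a <;> simp [pureBits, evolve, ih, add_assoc]

theorem numRounds_append (as bs : List (Action F q)) :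
    numRounds (as ++ bs) = numRounds as + numRounds bs := by
  induction as with
  | nil => simp [numRounds]
  | cons a as ih => cases a <;> simp [numRounds, ih]; omega

/-! ### Inverse runs -/

theorem toLin_inverse_toLin {a : Action F q} (ha : a.IsUnitary) (ψ : Config F q N → ℂ) :
    a.inverse.toLin N (a.toLin N ψ) = ψ := by
  cases a with
  | localOp U =>
    change (tensor fun v => (U (N.deg v))ᴴ) *ᵥ (tensor (fun v => U (N.deg v)) *ᵥ ψ) = ψ
    rw [Matrix.mulVec_mulVec, ← conjTranspose_tensor,
      conjTranspose_tensor_mul_self fun v => ha _, Matrix.one_mulVec]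
  | measure i => exact ha.elim
  | exchange =>
    funext c
    exact congrArg ψ (swapMessages_swapMessages c)

theorem evolve_inverse_evolve {as : List (Action F q)} (has : ∀ a ∈ as, a.IsUnitary)
    (ψ : Config F q N → ℂ) :
    evolve N (as.reverse.map Action.inverse) (evolve N as ψ) = ψ := by
  induction as generalizing ψ with
  | nil => rfl
  | cons a as ih =>
    rw [List.forall_mem_cons] at has
    rw [List.reverse_cons, List.map_append, evolve_append]
    change a.inverse.toLin N (evolve N _ (evolve N as (a.toLin N ψ))) = ψ
    rw [ih has.2, toLin_inverse_toLin has.1]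

/-- The count is a sum over all ports, and an exchange merely permutes the ports by the involution
`N.link`. -/
theorem messageBits_swapMessages (ψ : Config F q N → ℂ) :
    messageBits N (Action.exchange.toLin N ψ) = messageBits N ψ := by
  classical
  have key : ∀ φ : Config F q N → ℂ, messageBits N φ = ∑ p : Σ v, Fin (N.deg v),
      (Finset.univ.filter fun c => φ c ≠ 0).sup fun c => (msgAt c p).len := by
    intro φ
    rw [Fintype.sum_sigma, messageBits]
    congr! 5
  rw [key, key]
  refine Fintype.sum_equiv ⟨N.link, N.link, N.link_link, N.link_link⟩ _ _ fun p => ?_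
  apply le_antisymm
  · refine Finset.sup_le fun c hc => ?_
    have hc' : ψ (swapMessages F q N c) ≠ 0 := (Finset.mem_filter.1 hc).2
    refine le_trans (le_of_eq ?_) (Finset.le_sup (f := fun c => (msgAt c (N.link p)).len)
      (Finset.mem_filter.2 ⟨Finset.mem_univ _, hc'⟩))
    simp only [msgAt_swapMessages, N.link_link]
  · refine Finset.sup_le fun c hc => ?_
    have hc' : Action.exchange.toLin N ψ (swapMessages F q N c) ≠ 0 := by
      change ψ (swapMessages F q N (swapMessages F q N c)) ≠ 0
      rw [swapMessages_swapMessages]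
      exact (Finset.mem_filter.1 hc).2
    have hm : swapMessages F q N c ∈
        Finset.univ.filter fun c => Action.exchange.toLin N ψ c ≠ 0 :=
      Finset.mem_filter.2 ⟨Finset.mem_univ _, hc'⟩
    exact Finset.le_sup (f := fun c => (msgAt c p).len) hm

/-- The inverse run visits the states of the forward run in reverse order. Its exchanges start from
the state after the forward exchange, where the count is the same. -/
theorem pureBits_inverse {as : List (Action F q)} (has : ∀ a ∈ as, a.IsUnitary)
    (ψ : Config F q N → ℂ) :
    pureBits N (as.reverse.map Action.inverse) (evolve N as ψ) = pureBits N as ψ := by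
  induction as generalizing ψ with
  | nil => rfl
  | cons a as ih =>
    rw [List.forall_mem_cons] at has
    rw [List.reverse_cons, List.map_append, pureBits_append]
    change pureBits N _ (evolve N as (a.toLin N ψ)) +
      pureBits N [a.inverse] (evolve N _ (evolve N as (a.toLin N ψ))) = _
    rw [ih has.2, evolve_inverse_evolve has.2]
    cases a with
    | localOp U => simp [pureBits, Action.inverse]
    | measure i => exact has.1.elim
    | exchange =>
      simp only [pureBits, Action.inverse, messageBits_swapMessages]
      omega

/-! ### Bounds on the number of bits -/

theorem messageBits_le (ψ : Config F q N → ℂ) :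
    messageBits N ψ ≤ ∑ v, ∑ _i : Fin (N.deg v), F.maxLen :=
  Finset.sum_le_sum fun v _ => Finset.sum_le_sum fun i _ => Finset.sup_le fun c _ =>
    Nat.lt_succ_iff.1 ((c v).2.2 i).1.2

/-- A crude bound, needed only so that the supremum defining `Qbit` is over a bounded set. -/
theorem pureBits_le (as : List (Action F q)) (ψ : Config F q N → ℂ) :
    pureBits N as ψ ≤ numRounds as * ∑ v, ∑ _i : Fin (N.deg v), F.maxLen := by
  induction as generalizing ψ with
  | nil => simp [pureBits]
  | cons a as ih =>
    cases a with
    | localOp U => exact ih _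
    | measure i => exact ih _
    | exchange =>
      rw [pureBits, numRounds, add_mul, one_mul, add_comm]
      exact add_le_add (ih _) (messageBits_le ψ)

end pure

/-! ### Running an algorithm on selected qudits -/

section slices
variable {F : UnitaryAlgorithm k} {q n : ℕ} {N : Network n}

/-- The action on the qudits selected by `e`. -/
def Action.embed (e : Fin 2 ↪ Fin q) : Action F 2 → Action F q
  | .localOp U => .localOp fun d => lift e (U d)
  | .measure i => .measure (e i)
  | .exchange => .exchange

theorem lift_refl {a : ℕ} {W : Type}
    (M : Matrix ((Fin a → ZMod k) × W) ((Fin a → ZMod k) × W) ℂ) :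
    lift (Function.Embedding.refl (Fin a)) M = M := by
  ext c c'
  simp only [lift, Matrix.of_apply]
  rw [if_pos fun j hj => (hj ⟨j, rfl⟩).elim]
  rfl

theorem actions_eq_map_embed (F : UnitaryAlgorithm k) (e : Fin 2 ↪ Fin q) :
    F.actions e = F.ownActions.map (Action.embed e) := by
  simp [UnitaryAlgorithm.ownActions, UnitaryAlgorithm.actions, lift_refl, List.map_flatMap,
    Action.embed]

theorem conjTranspose_lift {a : ℕ} {W : Type} (e : Fin a ↪ Fin q)
    (M : Matrix ((Fin a → ZMod k) × W) ((Fin a → ZMod k) × W) ℂ) :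
    (lift e M)ᴴ = lift e Mᴴ := by
  ext c c'
  simp only [lift, Matrix.of_apply, Matrix.conjTranspose_apply]
  rw [apply_ite star, star_zero]
  congr! 3
  exact eq_comm

theorem inverse_embed (e : Fin 2 ↪ Fin q) (a : Action F 2) :
    (a.embed e).inverse = a.inverse.embed e := by
  cases a <;> simp [Action.embed, Action.inverse, conjTranspose_lift]

theorem inverse_actions_eq_map_embed (F : UnitaryAlgorithm k) (e : Fin 2 ↪ Fin q) :
    (F.actions e).reverse.map Action.inverse =
      (F.ownActions.reverse.map Action.inverse).map (Action.embed e) := by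
  rw [actions_eq_map_embed, ← List.map_reverse, List.map_map, List.map_map]
  exact List.map_congr_left fun a _ => inverse_embed e a

theorem isUnitary_ownActions (F : UnitaryAlgorithm k) : ∀ a ∈ F.ownActions, a.IsUnitary := by
  have h : ∀ t, Action.IsUnitary (F := F) (q := 2)
      (.localOp fun d => lift (Function.Embedding.refl (Fin 2)) (F.step t d).1) := by
    intro t d
    beta_reduce
    rw [lift_refl]
    exact Matrix.mem_unitaryGroup_iff'.1 (F.step t d).2
  intro a ha
  simp only [UnitaryAlgorithm.ownActions, UnitaryAlgorithm.actions, List.mem_append,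
    List.mem_flatMap, List.mem_cons, List.not_mem_nil, or_false] at ha
  rcases ha with ⟨t, -, rfl | rfl⟩ | rfl
  · exact h t
  · trivial
  · exact h _

/-- The configuration with the qudits selected by `e` and the work spaces as in `c`, and the other
qudits as in `r`. -/
def glue (e : Fin 2 ↪ Fin q) (r : Fin n → Fin q → ZMod k) (c : Config F 2 N) : Config F q N :=
  fun v => (Function.extend e (c v).1 (r v), (c v).2)

/-- The qudits selected by `e` and the work spaces. -/
def restrict (e : Fin 2 ↪ Fin q) (c : Config F q N) : Config F 2 N :=
  fun v => ((c v).1 ∘ e, (c v).2)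

theorem extend_comp_self (e : Fin 2 ↪ Fin q) (x y : Fin q → ZMod k)
    (h : ∀ j, j ∉ Set.range e → y j = x j) : Function.extend e (x ∘ e) y = x := by
  funext j
  by_cases hj : ∃ i, e i = j
  · obtain ⟨i, rfl⟩ := hj
    exact e.injective.extend_apply _ _ _
  · rw [Function.extend_apply' _ _ _ hj]
    exact h j hj

theorem restrict_glue (e : Fin 2 ↪ Fin q) (r : Fin n → Fin q → ZMod k) (c : Config F 2 N) :
    restrict e (glue e r c) = c :=
  funext fun _ => Prod.ext (funext fun i => e.injective.extend_apply _ _ i) rfl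

theorem glue_restrict (e : Fin 2 ↪ Fin q) (c : Config F q N) :
    glue e (fun v => (c v).1) (restrict e c) = c :=
  funext fun _ => Prod.ext (extend_comp_self e _ _ fun _ _ => rfl) rfl

/-- The part of a vector where the qudits not selected by `e` have the values `r`. -/
def slice (e : Fin 2 ↪ Fin q) (r : Fin n → Fin q → ZMod k) :
    (Config F q N → ℂ) →ₗ[ℂ] (Config F 2 N → ℂ) :=
  LinearMap.funLeft ℂ ℂ (glue e r)

/-- A lifted operator has no matrix entries between configurations that differ in an unselected
qudit, so the slices evolve independently of each other. -/
theorem slice_toLin_embed (e : Fin 2 ↪ Fin q) (r : Fin n → Fin q → ZMod k) (a : Action F 2)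
    (ψ : Config F q N → ℂ) :
    slice e r ((a.embed e).toLin N ψ) = a.toLin N (slice e r ψ) := by
  cases a with
  | measure i => rfl
  | exchange => rfl
  | localOp U =>
    funext c
    change ∑ c' : Config F q N, (∏ v, lift e (U (N.deg v)) (glue e r c v) (c' v)) * ψ c' =
      ∑ d : Config F 2 N, (∏ v, U (N.deg v) (c v) (d v)) * ψ (glue e r d)
    symm
    refine Fintype.sum_of_injective (glue e r)
      (Function.LeftInverse.injective (restrict_glue e r)) _ _ ?_ ?_
    · intro c' hc'
      have : ∃ v, ¬ ∀ j, j ∉ Set.range e → (glue e r c v).1 j = (c' v).1 j := by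
        by_contra! h
        refine hc' ⟨restrict e c', ?_⟩
        funext v
        refine Prod.ext (extend_comp_self e _ _ fun j hj => ?_) rfl
        exact (Function.extend_apply' _ _ _ hj).symm.trans (h v j hj)
      obtain ⟨v, hv⟩ := this
      rw [Finset.prod_eq_zero (Finset.mem_univ v), zero_mul]
      simp only [lift, Matrix.of_apply]
      rw [if_neg hv]
    · intro d
      congr 1
      refine Finset.prod_congr rfl fun v _ => ?_
      simp only [lift, Matrix.of_apply]
      rw [if_pos]
      · exact congrArg₂ (U (N.deg v)) (congrFun (restrict_glue e r c) v).symm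
          (congrFun (restrict_glue e r d) v).symm
      · intro j hj
        exact (Function.extend_apply' _ _ _ hj).trans (Function.extend_apply' _ _ _ hj).symm

theorem slice_evolve_embed (e : Fin 2 ↪ Fin q) (r : Fin n → Fin q → ZMod k)
    (as : List (Action F 2)) (ψ : Config F q N → ℂ) :
    slice e r (evolve N (as.map (Action.embed e)) ψ) = evolve N as (slice e r ψ) := by
  induction as generalizing ψ with
  | nil => rfl
  | cons a as ih =>
    change slice e r (evolve N (as.map (Action.embed e)) ((a.embed e).toLin N ψ)) =
      evolve N as (a.toLin N (slice e r ψ))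
    rw [ih, slice_toLin_embed]

theorem apply_eq_slice (e : Fin 2 ↪ Fin q) (ψ : Config F q N → ℂ) (c : Config F q N) :
    ψ c = slice e (fun v => (c v).1) ψ (restrict e c) :=
  (congrArg ψ (glue_restrict e c)).symm

/-- Only supports matter: each configuration in the support of `ψ` restricts to one in the support
of some `χ i`, and a maximum over a union is at most the sum of the maxima. -/
theorem messageBits_le_sum {ι : Type*} [Fintype ι] (e : Fin 2 ↪ Fin q) (ψ : Config F q N → ℂ)
    (χ : ι → Config F 2 N → ℂ) (h : ∀ r, ∃ i, ∃ α : ℂ, slice e r ψ = α • χ i) :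
    messageBits N ψ ≤ ∑ i, messageBits N (χ i) := by
  classical
  simp only [messageBits]
  rw [Finset.sum_comm]
  refine Finset.sum_le_sum fun v _ => ?_
  rw [Finset.sum_comm]
  refine Finset.sum_le_sum fun p _ => Finset.sup_le fun c hc => ?_
  obtain ⟨i, α, hi⟩ := h fun v => (c v).1
  have hc' : χ i (restrict e c) ≠ 0 := by
    intro h0
    have := (Finset.mem_filter.1 hc).2
    exact this <| by rw [apply_eq_slice e ψ c, hi, Pi.smul_apply, h0, smul_zero]
  refine le_trans ?_ (Finset.single_le_sum (fun _ _ => Nat.zero_le _) (Finset.mem_univ i))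
  have hm : restrict e c ∈ Finset.univ.filter fun c => χ i c ≠ 0 :=
    Finset.mem_filter.2 ⟨Finset.mem_univ _, hc'⟩
  exact Finset.le_sup (f := fun c : Config F 2 N => ((c v).2.2 p).len) hm

theorem pureBits_embed_le_sum {ι : Type*} [Fintype ι] (e : Fin 2 ↪ Fin q)
    (as : List (Action F 2)) (ψ : Config F q N → ℂ) (χ : ι → Config F 2 N → ℂ)
    (h : ∀ r, ∃ i, ∃ α : ℂ, slice e r ψ = α • χ i) :
    pureBits N (as.map (Action.embed e)) ψ ≤ ∑ i, pureBits N as (χ i) := by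
  induction as generalizing ψ χ with
  | nil => simp [pureBits]
  | cons a as ih =>
    have step : ∀ r, ∃ i, ∃ α : ℂ, slice e r ((a.embed e).toLin N ψ) = α • a.toLin N (χ i) := by
      intro r
      obtain ⟨i, α, hi⟩ := h r
      exact ⟨i, α, by rw [slice_toLin_embed, hi, map_smul]⟩
    cases a with
    | localOp U => exact ih _ _ step
    | measure j => exact ih _ _ step
    | exchange =>
      simp only [pureBits, List.map_cons, Action.embed, Finset.sum_add_distrib]
      exact add_le_add (messageBits_le_sum e ψ χ h) (ih _ _ step)

theorem messageBits_smul_le (α : ℂ) (ψ : Config F q N → ℂ) :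
    messageBits N (α • ψ) ≤ messageBits N ψ := by
  classical
  refine Finset.sum_le_sum fun v _ => Finset.sum_le_sum fun p _ => Finset.sup_mono ?_
  intro c hc
  simp only [Finset.mem_filter, Finset.mem_univ, true_and, Pi.smul_apply] at hc ⊢
  exact right_ne_zero_of_smul hc

theorem pureBits_smul_le (as : List (Action F q)) (α : ℂ) (ψ : Config F q N → ℂ) :
    pureBits N as (α • ψ) ≤ pureBits N as ψ := by
  induction as generalizing ψ with
  | nil => simp [pureBits]
  | cons a as ih =>
    cases a <;> simp only [pureBits, map_smul]
    · exact ih _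
    · exact ih _
    · exact add_le_add (messageBits_smul_le α ψ) (ih _)

/-! ### Inputs -/

/-- The vector `∑ x, φ x |x⟩` with outputs `|0⟩` and initial work spaces. -/
def inputVec (F : UnitaryAlgorithm k) (N : Network n) (φ : (Fin n → ZMod k) → ℂ) :
    Config F 2 N → ℂ :=
  open Classical in
  fun c => if ∀ v, (c v).1 1 = 0 ∧ (c v).2 = F.work0 (N.deg v) then φ fun v => (c v).1 0 else 0

theorem inputState_eq (φ : (Fin n → ZMod k) → ℂ) :
    F.inputState N φ = Matrix.vecMulVec (inputVec F N φ) (star (inputVec F N φ)) := rfl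

theorem inputVec_smul (α : ℂ) (φ : (Fin n → ZMod k) → ℂ) :
    inputVec F N (α • φ) = α • inputVec F N φ := by
  funext c
  simp [inputVec]

theorem inputVec_eq_sum (φ : (Fin n → ZMod k) → ℂ) :
    inputVec F N φ = ∑ x, φ x • inputVec F N (Pi.single x 1) := by
  funext c
  simp only [inputVec, Finset.sum_apply, Pi.smul_apply, smul_eq_mul]
  split_ifs
  · simp [Pi.single_apply]
  · simp

theorem exists_unit_smul (φ : (Fin n → ZMod k) → ℂ) :
    ∃ (α : ℂ) (φ' : (Fin n → ZMod k) → ℂ), ∑ x, ‖φ' x‖ ^ 2 = 1 ∧ φ = α • φ' := by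
  by_cases h : φ = 0
  -- The zero vector is `0` times an arbitrary unit vector.
  · refine ⟨0, Pi.single 0 1, ?_, by simp [h]⟩
    rw [Finset.sum_eq_single 0]
    · simp
    · intro x _ hx
      simp [Pi.single_eq_of_ne hx]
    · simp
  · have hpos : 0 < ∑ x, ‖φ x‖ ^ 2 := by
      obtain ⟨x, hx⟩ := Function.ne_iff.1 h
      exact Finset.sum_pos' (fun _ _ => by positivity)
        ⟨x, Finset.mem_univ x, by have := norm_pos_iff.2 hx; positivity⟩
    have hs : (0 : ℝ) < Real.sqrt (∑ x, ‖φ x‖ ^ 2) := Real.sqrt_pos.2 hpos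
    refine ⟨(Real.sqrt (∑ x, ‖φ x‖ ^ 2) : ℂ), ((Real.sqrt (∑ x, ‖φ x‖ ^ 2) : ℂ)⁻¹) • φ, ?_, ?_⟩
    · simp only [Pi.smul_apply, smul_eq_mul, norm_mul, norm_inv, Complex.norm_real, mul_pow,
        ← Finset.mul_sum, Real.norm_eq_abs, abs_of_pos hs, inv_pow, Real.sq_sqrt hpos.le]
      exact inv_mul_cancel₀ hpos.ne'
    · rw [smul_smul, mul_inv_cancel₀ (by exact_mod_cast hs.ne'), one_smul]

theorem pureBits_inputVec_le (φ : (Fin n → ZMod k) → ℂ) :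
    pureBits N F.ownActions (inputVec F N φ) ≤ F.Qbit N := by
  obtain ⟨α, φ', hφ', rfl⟩ := exists_unit_smul φ
  rw [inputVec_smul]
  refine (pureBits_smul_le _ _ _).trans ?_
  have hp : ∀ a ∈ F.ownActions, a.IsPure := fun a ha => (isUnitary_ownActions F a ha).isPure
  rw [← numBits_vecMulVec hp, ← inputState_eq]
  refine le_ciSup (f := fun φ : {φ : (Fin n → ZMod k) → ℂ // ∑ x, ‖φ x‖ ^ 2 = 1} =>
    numBits N F.ownActions (F.inputState N φ)) ⟨numRounds F.ownActions *
      ∑ v, ∑ _i : Fin (N.deg v), F.maxLen, ?_⟩ ⟨φ', hφ'⟩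
  rintro _ ⟨φ, rfl⟩
  simp only [inputState_eq, numBits_vecMulVec hp]
  exact pureBits_le _ _

end slices

/-! ### Computing the sum into a further qudit -/

section block
variable {F : UnitaryAlgorithm k} {q n : ℕ} {N : Network n}

/-- The indicator vector of the inputs with sum `s`. -/
def sumIndicator (k n : ℕ) [NeZero k] (s : ZMod k) : (Fin n → ZMod k) → ℂ :=
  fun x => if sumMod k n x = s then 1 else 0

theorem inputVec_one_eq_sum :
    inputVec F N 1 = ∑ s, inputVec F N (sumIndicator k n s) := by
  funext c
  simp only [inputVec, Finset.sum_apply]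
  split_ifs
  · simp [sumIndicator]
  · simp

/-- By linearity a nonzero amplitude must come from some basis input with sum `s`, and on basis
inputs the output is certain, whatever the garbage. -/
theorem evolve_sumIndicator_ne_zero (hF : F.Computes N (sumMod k n)) {s : ZMod k}
    {c : Config F 2 N} (hc : evolve N F.ownActions (inputVec F N (sumIndicator k n s)) c ≠ 0)
    (v : Fin n) : (c v).1 1 = s := by
  rw [inputVec_eq_sum, map_sum, Finset.sum_apply] at hc
  obtain ⟨x, -, hx⟩ := Finset.exists_ne_zero_of_sum_ne_zero hc
  rw [map_smul, Pi.smul_apply, smul_eq_mul] at hx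
  have hs : sumMod k n x = s := by
    by_contra h
    simp [sumIndicator, h] at hx
  rw [← hs]
  refine hF x c ?_ v
  rw [inputState_eq, run_vecMulVec fun a ha => (isUnitary_ownActions F a ha).isPure,
    Matrix.vecMulVec_apply, Pi.star_apply]
  exact mul_ne_zero (right_ne_zero_of_mul hx) (star_ne_zero.2 (right_ne_zero_of_mul hx))

theorem evolve_one_eq_zero (hF : F.Computes N (sumMod k n)) (v₀ : Fin n) {c : Config F 2 N}
    (hc : ¬ ∀ v, (c v).1 1 = (c v₀).1 1) : evolve N F.ownActions (inputVec F N 1) c = 0 := by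
  rw [inputVec_one_eq_sum, map_sum, Finset.sum_apply]
  refine Finset.sum_eq_zero fun s _ => ?_
  by_contra h
  exact hc fun v => (evolve_sumIndicator_ne_zero hF h v).trans
    (evolve_sumIndicator_ne_zero hF h v₀).symm

/-- The output at any one party identifies the branch, so at a given configuration only one term of
the sum over `s` survives. -/
theorem evolve_one_eq (hF : F.Computes N (sumMod k n)) (v₀ : Fin n) (c : Config F 2 N) :
    evolve N F.ownActions (inputVec F N 1) c =
      evolve N F.ownActions (inputVec F N (sumIndicator k n ((c v₀).1 1))) c := by
  rw [inputVec_one_eq_sum, map_sum, Finset.sum_apply]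
  refine Finset.sum_eq_single _ (fun s _ hs => ?_) fun h => (h (Finset.mem_univ _)).elim
  by_contra h
  exact hs (evolve_sumIndicator_ne_zero hF h v₀).symm

/-- The vector with amplitudes `χ` where all work spaces are in their initial states. -/
def clean (F : UnitaryAlgorithm k) (N : Network n) (χ : (Fin n → Fin q → ZMod k) → ℂ) :
    Config F q N → ℂ :=
  open Classical in
  fun c => if ∀ v, (c v).2 = F.work0 (N.deg v) then χ fun v => (c v).1 else 0

/-- Subtraction of qudit `i` from qudit `j`. -/
def subtract (i j : Fin q) (x : Fin q → ZMod k) : Fin q → ZMod k :=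
  Function.update x j (x j - x i)

/-- The amplitudes `f`, restricted to the configurations with
qudits `b` and `j` zero at every party. -/
def uniformAmp (b j : Fin q) (f : (Fin n → Fin q → ZMod k) → ℂ) :
    (Fin n → Fin q → ZMod k) → ℂ :=
  fun y => if (∀ v, y v b = 0) ∧ ∀ v, y v j = 0 then f y else 0

/-- As `uniformAmp`, with the sum of the qudits `a` of all parties in qudit `j`. -/
def sumAmp (a b j : Fin q) (f : (Fin n → Fin q → ZMod k) → ℂ) :
    (Fin n → Fin q → ZMod k) → ℂ :=
  fun y => if (∀ v, y v b = 0) ∧ ∀ v, y v j = sumMod k n fun w => y w a then f y else 0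

variable (e : Fin 2 ↪ Fin q) (j : Fin q) (f : (Fin n → Fin q → ZMod k) → ℂ)

/-- The function `f` depends on the qudits other than `e 0`, `e 1` and `j` only. -/
def IndependentOf : Prop :=
  ∀ y y' : Fin n → Fin q → ZMod k,
    (∀ v i, i ≠ e 0 → i ≠ e 1 → i ≠ j → y v i = y' v i) → f y = f y'

variable {e j f}

/-- As `f` does not see the qudits of `e`, it is constant on a slice, and all inputs occur there
with the same amplitude. -/
theorem slice_clean_uniformAmp (hj : j ∉ Set.range e) (hf : IndependentOf e j f)
    (r : Fin n → Fin q → ZMod k) :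
    slice e r (clean F N (uniformAmp (e 1) j f)) =
      (if ∀ v, r v j = 0 then f r else 0) • inputVec F N 1 := by
  classical
  have h1 : ∀ (x : Fin 2 → ZMod k) (y : Fin q → ZMod k), Function.extend e x y (e 1) = x 1 :=
    fun x y => e.injective.extend_apply _ _ _
  have h2 : ∀ (x : Fin 2 → ZMod k) (y : Fin q → ZMod k), Function.extend e x y j = y j :=
    fun x y => Function.extend_apply' _ _ _ hj
  funext c
  have h3 : f (fun v => Function.extend e (c v).1 (r v)) = f r := by
    refine hf _ _ fun v i h0 h1 _ => Function.extend_apply' _ _ _ ?_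
    rintro ⟨l, rfl⟩
    fin_cases l
    · exact h0 rfl
    · exact h1 rfl
  change clean F N _ (glue e r c) = _
  simp only [clean, uniformAmp, glue, inputVec, Pi.smul_apply, smul_eq_mul, h1, h2, h3,
    forall_and, Pi.one_apply]
  by_cases ha : ∀ v, (c v).2 = F.work0 (N.deg v) <;> by_cases hb : ∀ v, (c v).1 1 = 0 <;>
    by_cases hd : ∀ v, r v j = 0 <;> simp [ha, hb, hd]

theorem slice_clean_sumAmp (hj : j ∉ Set.range e) (hf : IndependentOf e j f) (v₀ : Fin n)
    (r : Fin n → Fin q → ZMod k) :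
    slice e r (clean F N (sumAmp (e 0) (e 1) j f)) =
      (if ∀ v, r v j = r v₀ j then f r else 0) • inputVec F N (sumIndicator k n (r v₀ j)) := by
  classical
  have h0 : ∀ (x : Fin 2 → ZMod k) (y : Fin q → ZMod k), Function.extend e x y (e 0) = x 0 :=
    fun x y => e.injective.extend_apply _ _ _
  have h1 : ∀ (x : Fin 2 → ZMod k) (y : Fin q → ZMod k), Function.extend e x y (e 1) = x 1 :=
    fun x y => e.injective.extend_apply _ _ _
  have h2 : ∀ (x : Fin 2 → ZMod k) (y : Fin q → ZMod k), Function.extend e x y j = y j :=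
    fun x y => Function.extend_apply' _ _ _ hj
  funext c
  have h3 : f (fun v => Function.extend e (c v).1 (r v)) = f r := by
    refine hf _ _ fun v i h0 h1 _ => Function.extend_apply' _ _ _ ?_
    rintro ⟨l, rfl⟩
    fin_cases l
    · exact h0 rfl
    · exact h1 rfl
  change clean F N _ (glue e r c) = _
  simp only [clean, sumAmp, glue, inputVec, Pi.smul_apply, smul_eq_mul, h0, h1, h2, h3,
    forall_and, sumIndicator]
  -- The condition splits into one on the slice (all copies agree) and one on the inputs (their sum
  -- is the common copy).
  have h4 : (∀ v, r v j = sumMod k n fun w => (c w).1 0) ↔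
      (∀ v, r v j = r v₀ j) ∧ (sumMod k n fun w => (c w).1 0) = r v₀ j :=
    ⟨fun h => ⟨fun v => (h v).trans (h v₀).symm, (h v₀).symm⟩,
      fun h v => (h.1 v).trans h.2.symm⟩
  simp only [h4]
  by_cases ha : ∀ v, (c v).2 = F.work0 (N.deg v) <;> by_cases hb : ∀ v, (c v).1 1 = 0 <;>
    by_cases hd : ∀ v, r v j = r v₀ j <;> simp [ha, hb, hd]

theorem extend_subtract (hj : j ∉ Set.range e) (x : Fin 2 → ZMod k) (y : Fin q → ZMod k) :
    subtract (e 1) j (Function.extend e x y) =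
      Function.extend e x (Function.update y j (y j - x 1)) := by
  funext i
  by_cases hi : ∃ l, e l = i
  · obtain ⟨l, rfl⟩ := hi
    have : e l ≠ j := fun h => hj ⟨l, h⟩
    rw [subtract, Function.update_of_ne this, e.injective.extend_apply, e.injective.extend_apply]
  · rw [Function.extend_apply' _ _ _ hi, subtract]
    by_cases hij : i = j
    · subst hij
      rw [Function.update_self, Function.update_self, Function.extend_apply' _ _ _ hi,
        e.injective.extend_apply]
    · rw [Function.update_of_ne hij, Function.update_of_ne hij, Function.extend_apply' _ _ _ hi]

/-- The vector after subtracting qudit `e 1` from qudit `j` at every party. -/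
def subtractVec (i j : Fin q) (ψ : Config F q N → ℂ) : Config F q N → ℂ :=
  fun c => ψ fun v => (subtract i j (c v).1, (c v).2)

/-- Qudit `j` records the output, which is constant on each branch. Fixing it therefore selects the
complete evolved branch with that sum and cuts nothing off, so the branch can still be uncomputed.
-/
theorem slice_subtractVec (hF : F.Computes N (sumMod k n)) (hj : j ∉ Set.range e)
    (hf : IndependentOf e j f) (v₀ : Fin n) (r : Fin n → Fin q → ZMod k) :
    slice e r (subtractVec (e 1) j
        (evolve N (F.actions e) (clean F N (uniformAmp (e 1) j f)))) =
      (if ∀ v, r v j = r v₀ j then f r else 0) •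
        evolve N F.ownActions (inputVec F N (sumIndicator k n (r v₀ j))) := by
  classical
  funext c
  -- The copying gate shifts qudit `j` by the output, so the value at `c` is read from a slice `r'`
  -- that depends on `c`.
  set r' : Fin n → Fin q → ZMod k := fun v => Function.update (r v) j (r v j - (c v).1 1) with hr'
  have h1 : slice e r (subtractVec (e 1) j
      (evolve N (F.actions e) (clean F N (uniformAmp (e 1) j f)))) c =
      slice e r' (evolve N (F.actions e) (clean F N (uniformAmp (e 1) j f))) c := by
    refine congrArg (evolve N (F.actions e) (clean F N (uniformAmp (e 1) j f))) ?_
    funext v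
    exact Prod.ext (extend_subtract hj _ _) rfl
  have h2 : f r' = f r := hf _ _ fun v i _ _ hi => Function.update_of_ne hi _ _
  have h3 : (∀ v, r' v j = 0) ↔ ∀ v, r v j = (c v).1 1 := by
    simp only [hr', Function.update_self, sub_eq_zero]
  rw [h1, actions_eq_map_embed, slice_evolve_embed, slice_clean_uniformAmp hj hf, map_smul,
    Pi.smul_apply, Pi.smul_apply, h2]
  simp only [h3, smul_eq_mul]
  by_cases hc : ∀ v, r v j = (c v).1 1
  · rw [if_pos hc]
    by_cases hr : ∀ v, r v j = r v₀ j
    · rw [if_pos hr, evolve_one_eq hF v₀, hc v₀]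
    · rw [if_neg hr, zero_mul, evolve_one_eq_zero hF v₀, mul_zero]
      -- Copies that disagree would mean outputs that disagree, which have amplitude zero.
      exact fun h => hr fun v => by rw [hc, hc, h]
  · rw [if_neg hc, zero_mul]
    by_cases hr : ∀ v, r v j = r v₀ j
    · symm
      refine mul_eq_zero_of_right _ ?_
      by_contra h
      exact hc fun v => (hr v).trans (evolve_sumIndicator_ne_zero hF h v).symm
    · rw [if_neg hr, zero_mul]

/-- Running `F`, copying its output to qudit `j` and running the inverse of `F` computes the sum
into qudit `j`. -/
theorem evolve_uncall (hF : F.Computes N (sumMod k n)) (hj : j ∉ Set.range e)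
    (hf : IndependentOf e j f) (v₀ : Fin n) :
    evolve N ((F.actions e).reverse.map Action.inverse) (subtractVec (e 1) j
        (evolve N (F.actions e) (clean F N (uniformAmp (e 1) j f)))) =
      clean F N (sumAmp (e 0) (e 1) j f) := by
  funext c
  rw [apply_eq_slice e (evolve N _ _), apply_eq_slice e (clean F N _),
    inverse_actions_eq_map_embed, slice_evolve_embed, slice_subtractVec hF hj hf v₀, map_smul,
    evolve_inverse_evolve (isUnitary_ownActions F), slice_clean_sumAmp hj hf v₀]

/-! ### Communication and rounds of a run and of its inverse -/

theorem pureBits_call (hj : j ∉ Set.range e) (hf : IndependentOf e j f) :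
    pureBits N (F.actions e) (clean F N (uniformAmp (e 1) j f)) ≤ F.Qbit N := by
  rw [actions_eq_map_embed]
  refine (pureBits_embed_le_sum e F.ownActions _ (fun _ : Unit => inputVec F N 1) fun r =>
    ⟨(), _, slice_clean_uniformAmp hj hf r⟩).trans ?_
  simpa using pureBits_inputVec_le (F := F) (N := N) 1

/-- After copying, the slices are multiples of `k` different vectors, one for each value of the sum,
instead of a single one; hence the factor `k`. -/
theorem pureBits_uncall (hF : F.Computes N (sumMod k n)) (hj : j ∉ Set.range e)
    (hf : IndependentOf e j f) (v₀ : Fin n) :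
    pureBits N ((F.actions e).reverse.map Action.inverse) (subtractVec (e 1) j
        (evolve N (F.actions e) (clean F N (uniformAmp (e 1) j f)))) ≤ k * F.Qbit N := by
  rw [inverse_actions_eq_map_embed]
  refine (pureBits_embed_le_sum e _ _
    (fun s => evolve N F.ownActions (inputVec F N (sumIndicator k n s))) fun r =>
    ⟨_, _, slice_subtractVec hF hj hf v₀ r⟩).trans ?_
  simp only [pureBits_inverse (isUnitary_ownActions F)]
  refine (Finset.sum_le_card_nsmul _ _ _ fun s _ => pureBits_inputVec_le _).trans ?_
  simp [ZMod.card]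

theorem numRounds_actions (F : UnitaryAlgorithm k) (e : Fin 2 ↪ Fin q) :
    numRounds (F.actions e) = F.Qrnd := by
  rw [actions_eq_map_embed, UnitaryAlgorithm.Qrnd]
  induction F.ownActions with
  | nil => rfl
  | cons a as ih => cases a <;> simp [numRounds, Action.embed, ih]

theorem numRounds_inverse_actions (F : UnitaryAlgorithm k) (e : Fin 2 ↪ Fin q) :
    numRounds ((F.actions e).reverse.map Action.inverse) = F.Qrnd := by
  rw [← numRounds_actions F e]
  induction F.actions e with
  | nil => rfl
  | cons a as ih =>
    rw [List.reverse_cons, List.map_append, numRounds_append, ih]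
    cases a <;> simp [numRounds, Action.inverse]

end block

/-! ### Gates -/

/-- The quantum Fourier transform on one qudit. -/
def fourier (k : ℕ) [NeZero k] : Matrix (ZMod k) (ZMod k) ℂ :=
  Matrix.of fun a b => ZMod.stdAddChar (a * b) * ((Real.sqrt k : ℝ) : ℂ)⁻¹

theorem sqrt_mul_sqrt (k : ℕ) : ((Real.sqrt k : ℝ) : ℂ) * ((Real.sqrt k : ℝ) : ℂ) = k := by
  rw [← Complex.ofReal_mul, Real.mul_self_sqrt (Nat.cast_nonneg k), Complex.ofReal_natCast]

theorem sqrt_ne_zero (k : ℕ) [NeZero k] : ((Real.sqrt k : ℝ) : ℂ) ≠ 0 := by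
  have h : (k : ℂ) ≠ 0 := NeZero.ne _
  rw [← sqrt_mul_sqrt] at h
  exact left_ne_zero_of_mul h

theorem sum_stdAddChar_mul (b : ZMod k) :
    ∑ a : ZMod k, (ZMod.stdAddChar (a * b) : ℂ) = if b = 0 then (k : ℂ) else 0 := by
  rw [AddChar.sum_mulShift b (ZMod.isPrimitive_stdAddChar k), ZMod.card]
  split_ifs <;> simp

theorem stdAddChar_sum {ι : Type*} [Fintype ι] (f : ι → ZMod k) :
    (ZMod.stdAddChar (∑ i, f i) : ℂ) = ∏ i, ZMod.stdAddChar (f i) :=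
  map_prod (ZMod.stdAddChar (N := k)).toMonoidHom (fun i => Multiplicative.ofAdd (f i)) _

theorem conj_stdAddChar (a : ZMod k) :
    star (ZMod.stdAddChar a : ℂ) = ZMod.stdAddChar (-a) := by
  rw [AddChar.map_neg_eq_conj]
  rfl

theorem conjTranspose_fourier_mul_self : (fourier k)ᴴ * fourier k = 1 := by
  ext a b
  have h : ∀ c : ZMod k, star (ZMod.stdAddChar (c * a) : ℂ) * ZMod.stdAddChar (c * b) =
      ZMod.stdAddChar (c * (b - a)) := by
    intro c
    rw [conj_stdAddChar, ← AddChar.map_add_eq_mul]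
    congr 1
    ring
  have hs : star ((Real.sqrt k : ℝ) : ℂ)⁻¹ = ((Real.sqrt k : ℝ) : ℂ)⁻¹ := by simp
  calc ((fourier k)ᴴ * fourier k) a b
      = ∑ c, star (ZMod.stdAddChar (c * a) * ((Real.sqrt k : ℝ) : ℂ)⁻¹) *
          (ZMod.stdAddChar (c * b) * ((Real.sqrt k : ℝ) : ℂ)⁻¹) := rfl
    _ = ∑ c, ZMod.stdAddChar (c * (b - a)) * (k : ℂ)⁻¹ := by
        refine Finset.sum_congr rfl fun c _ => ?_
        rw [star_mul', hs, ← h, ← sqrt_mul_sqrt, mul_inv]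
        ring
    _ = (1 : Matrix (ZMod k) (ZMod k) ℂ) a b := by
        rw [← Finset.sum_mul, sum_stdAddChar_mul, Matrix.one_apply]
        by_cases hab : a = b
        · simp [hab, NeZero.ne k]
        · rw [if_neg hab, if_neg (sub_ne_zero.2 (Ne.symm hab)), zero_mul]

/-- The Fourier transform on qudits `0` and `3` out of five. -/
def fourierGate (k : ℕ) [NeZero k] : Matrix (Fin 5 → ZMod k) (Fin 5 → ZMod k) ℂ :=
  tensor ![fourier k, 1, 1, fourier k, 1]

theorem fourierGate_mem : fourierGate k ∈ Matrix.unitaryGroup (Fin 5 → ZMod k) ℂ := by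
  rw [Matrix.mem_unitaryGroup_iff', Matrix.star_eq_conjTranspose]
  refine conjTranspose_tensor_mul_self fun i => ?_
  fin_cases i
  · exact conjTranspose_fourier_mul_self
  · simp
  · simp
  · exact conjTranspose_fourier_mul_self
  · simp

theorem fourierGate_apply (x y : Fin 5 → ZMod k) :
    fourierGate k x y = if y 1 = x 1 ∧ y 2 = x 2 ∧ y 4 = x 4 then
      fourier k (x 0) (y 0) * fourier k (x 3) (y 3) else 0 := by
  have h : fourierGate k x y = fourier k (x 0) (y 0) * (1 : Matrix (ZMod k) (ZMod k) ℂ) (x 1) (y 1)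
      * (1 : Matrix (ZMod k) (ZMod k) ℂ) (x 2) (y 2) * fourier k (x 3) (y 3)
      * (1 : Matrix (ZMod k) (ZMod k) ℂ) (x 4) (y 4) := by
    simp only [fourierGate, tensor, Matrix.of_apply, Fin.prod_univ_five]
    rfl
  rw [h]
  simp only [Matrix.one_apply, @eq_comm _ (y _)]
  by_cases h1 : x 1 = y 1 <;> by_cases h2 : x 2 = y 2 <;> by_cases h4 : x 4 = y 4 <;>
    simp [h1, h2, h4]

/-- The gate that maps the basis state `σ x` to the basis state `x`. -/
def permGate {a : ℕ} (σ : Equiv.Perm (Fin a → ZMod k)) :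
    Matrix (Fin a → ZMod k) (Fin a → ZMod k) ℂ :=
  Matrix.of fun x y => if σ x = y then 1 else 0

theorem permGate_mem {a : ℕ} (σ : Equiv.Perm (Fin a → ZMod k)) :
    permGate σ ∈ Matrix.unitaryGroup (Fin a → ZMod k) ℂ := by
  rw [Matrix.mem_unitaryGroup_iff, Matrix.star_eq_conjTranspose]
  ext x y
  simp [permGate, Matrix.mul_apply, Matrix.conjTranspose_apply, Matrix.one_apply, eq_comm]

/-- Subtraction of qudit `i` from qudit `j`, as a permutation. -/
def subtractPerm {q : ℕ} (i j : Fin q) (h : i ≠ j) : Equiv.Perm (Fin q → ZMod k) where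
  toFun := subtract i j
  invFun x := Function.update x j (x j + x i)
  left_inv x := by simp [subtract, Function.update_of_ne h]
  right_inv x := by simp [subtract, Function.update_of_ne h]

/-- For each `s` and `t`, some invertible linear map turns the form `z * s + w * t` into a multiple
of one coordinate. -/
theorem exists_perm_linear_form (k : ℕ) : ∃ (σ : Equiv.Perm (Fin 5 → ZMod k))
    (g : ZMod k → ZMod k → ZMod k), ∀ x, σ x 1 = x 1 ∧
      σ x 0 * σ x 2 + σ x 3 * σ x 4 = g (x 2) (x 4) * x 3 := by
  -- `ZMod k` need not be a domain, so the common factor is taken out of integer representatives and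
  -- the Bézout identity is reduced modulo `k`.
  have bezout : ∀ s t : ZMod k, ∃ g a b u v : ZMod k, s = g * a ∧ t = g * b ∧
      u * a + v * b = 1 := by
    intro s t
    obtain ⟨s, rfl⟩ := ZMod.intCast_surjective s
    obtain ⟨t, rfl⟩ := ZMod.intCast_surjective t
    obtain ⟨a, b, ha, hb, hab⟩ := extract_gcd s t
    obtain ⟨u, v, huv⟩ := (gcd_isUnit_iff a b).1 hab
    refine ⟨(gcd s t : ℤ), a, b, u, v, ?_, ?_, ?_⟩
    · rw [← Int.cast_mul, ← ha]
    · rw [← Int.cast_mul, ← hb]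
    · rw [← Int.cast_mul, ← Int.cast_mul, ← Int.cast_add, huv, Int.cast_one]
  choose g a b u v hs ht h using bezout
  -- On the pair `(x 3, x 0)` this is the matrix with rows `(u, -b)` and `(v, a)`, of determinant `u
  -- a + v b = 1`; the second function is its inverse. The terms `g a b x 0` cancel in the form.
  refine ⟨⟨fun x => ![u (x 2) (x 4) * x 3 - b (x 2) (x 4) * x 0, x 1, x 2,
      v (x 2) (x 4) * x 3 + a (x 2) (x 4) * x 0, x 4],
    fun x => ![u (x 2) (x 4) * x 3 - v (x 2) (x 4) * x 0, x 1, x 2,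
      a (x 2) (x 4) * x 0 + b (x 2) (x 4) * x 3, x 4], fun x => ?_, fun x => ?_⟩, g, fun x => ?_⟩
  · have h' := h (x 2) (x 4)
    funext i
    fin_cases i
    · change u (x 2) (x 4) * (v (x 2) (x 4) * x 3 + a (x 2) (x 4) * x 0) -
        v (x 2) (x 4) * (u (x 2) (x 4) * x 3 - b (x 2) (x 4) * x 0) = x 0
      linear_combination x 0 * h'
    · rfl
    · rfl
    · change a (x 2) (x 4) * (u (x 2) (x 4) * x 3 - b (x 2) (x 4) * x 0) +
        b (x 2) (x 4) * (v (x 2) (x 4) * x 3 + a (x 2) (x 4) * x 0) = x 3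
      linear_combination x 3 * h'
    · rfl
  · have h' := h (x 2) (x 4)
    funext i
    fin_cases i
    · change u (x 2) (x 4) * (a (x 2) (x 4) * x 0 + b (x 2) (x 4) * x 3) -
        b (x 2) (x 4) * (u (x 2) (x 4) * x 3 - v (x 2) (x 4) * x 0) = x 0
      linear_combination x 0 * h'
    · rfl
    · rfl
    · change v (x 2) (x 4) * (a (x 2) (x 4) * x 0 + b (x 2) (x 4) * x 3) +
        a (x 2) (x 4) * (u (x 2) (x 4) * x 3 - v (x 2) (x 4) * x 0) = x 3
      linear_combination x 3 * h'
    · rfl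
  · refine ⟨rfl, ?_⟩
    change (u (x 2) (x 4) * x 3 - b (x 2) (x 4) * x 0) * x 2 +
      (v (x 2) (x 4) * x 3 + a (x 2) (x 4) * x 0) * x 4 = g (x 2) (x 4) * x 3
    linear_combination (u (x 2) (x 4) * x 3 - b (x 2) (x 4) * x 0) * hs (x 2) (x 4) +
      (v (x 2) (x 4) * x 3 + a (x 2) (x 4) * x 0) * ht (x 2) (x 4) +
      g (x 2) (x 4) * x 3 * h (x 2) (x 4)

section gates
variable {F : UnitaryAlgorithm k} {q n : ℕ} {N : Network n}

/-- The action of a gate on all qudits. -/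
def gateAction (F : UnitaryAlgorithm k) (M : Matrix (Fin q → ZMod k) (Fin q → ZMod k) ℂ) :
    Action F q :=
  .localOp fun _ => lift (Function.Embedding.refl (Fin q)) (M ⊗ₖ 1)

theorem gateAction_toLin_apply (M : Matrix (Fin q → ZMod k) (Fin q → ZMod k) ℂ)
    (ψ : Config F q N → ℂ) (c : Config F q N) :
    (gateAction F M).toLin N ψ c =
      ∑ y : Fin n → Fin q → ZMod k, (∏ v, M (c v).1 (y v)) * ψ fun v => (y v, (c v).2) := by
  change ∑ c' : Config F q N, (∏ v, lift (Function.Embedding.refl (Fin q))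
    (M ⊗ₖ (1 : Matrix (F.Work (N.deg v)) _ ℂ)) (c v) (c' v)) * ψ c' = _
  simp only [lift_refl, Matrix.kroneckerMap_apply]
  symm
  refine Fintype.sum_of_injective
    (fun (y : Fin n → Fin q → ZMod k) => ((fun v => (y v, (c v).2)) : Config F q N))
    (fun y y' h => funext fun v => congrArg Prod.fst (congrFun h v)) _ _ ?_ ?_
  · intro c' hc'
    have : ∃ v, (c v).2 ≠ (c' v).2 := by
      by_contra! h
      exact hc' ⟨fun v => (c' v).1, funext fun v => Prod.ext rfl (h v)⟩
    obtain ⟨v, hv⟩ := this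
    rw [Finset.prod_eq_zero (Finset.mem_univ v), zero_mul]
    rw [Matrix.one_apply_ne hv, mul_zero]
  · intro y
    simp only [Matrix.one_apply_eq, mul_one]

theorem gateAction_toLin_clean (M : Matrix (Fin q → ZMod k) (Fin q → ZMod k) ℂ)
    (χ : (Fin n → Fin q → ZMod k) → ℂ) :
    (gateAction F M).toLin N (clean F N χ) =
      clean F N fun x => ∑ y, (∏ v, M (x v) (y v)) * χ y := by
  funext c
  rw [gateAction_toLin_apply]
  simp only [clean]
  split_ifs
  · rfl
  · simp

/-- Amplitudes are pulled back along `σ`. So the gate of `subtractPerm i j` adds qudit `i` to qudit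
`j` on basis states, which copies into a qudit that is zero. -/
theorem permGate_toLin (σ : Equiv.Perm (Fin q → ZMod k)) (ψ : Config F q N → ℂ) :
    (gateAction F (permGate σ)).toLin N ψ = fun c => ψ fun v => (σ (c v).1, (c v).2) := by
  funext c
  rw [gateAction_toLin_apply, Finset.sum_eq_single fun v => σ (c v).1]
  · simp [permGate]
  · intro y _ hy
    obtain ⟨v, hv⟩ := Function.ne_iff.1 hy
    rw [Finset.prod_eq_zero (Finset.mem_univ v), zero_mul]
    exact if_neg (Ne.symm hv)
  · exact fun h => (h (Finset.mem_univ _)).elim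

end gates

/-! ### The amplitudes during the program -/

section amplitudes
variable {n : ℕ}

/-- The amplitudes of the superposition, with amplitudes `β`, of the states in which all parties
hold the same values. -/
def constAmp (v₀ : Fin n) (β : (Fin 5 → ZMod k) → ℂ) : (Fin n → Fin 5 → ZMod k) → ℂ :=
  fun y => if ∀ v, y v = y v₀ then β (y v₀) else 0

/-- Weights of the first run: normalization and qudit `4` zero. -/
def weight₁ (k n : ℕ) [NeZero k] : (Fin n → Fin 5 → ZMod k) → ℂ :=
  fun y => if ∀ v, y v 4 = 0 then ((k : ℂ)⁻¹) ^ n else 0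

/-- Weights of the second run: normalization and the sum of qudits `0` in qudit `2`. -/
def weight₂ (k n : ℕ) [NeZero k] : (Fin n → Fin 5 → ZMod k) → ℂ :=
  fun y => if ∀ v, y v 2 = sumMod k n fun w => y w 0 then ((k : ℂ)⁻¹) ^ n else 0

theorem fourierGate_single_zero :
    (fun x : Fin n → Fin 5 → ZMod k => ∑ y, (∏ v, fourierGate k (x v) (y v)) *
      (Pi.single 0 1 : (Fin n → Fin 5 → ZMod k) → ℂ) y) =
      uniformAmp 1 2 (weight₁ k n) := by
  funext x
  rw [Finset.sum_eq_single 0]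
  · have h : ∀ v, fourierGate k (x v) 0 =
        if x v 1 = 0 ∧ x v 2 = 0 ∧ x v 4 = 0 then (k : ℂ)⁻¹ else 0 := by
      intro v
      rw [fourierGate_apply, ← sqrt_mul_sqrt, mul_inv]
      simp [fourier, eq_comm]
    simp only [Pi.single_eq_same, mul_one, Pi.zero_apply, h, Finset.prod_ite_zero,
      Finset.mem_univ, true_imp_iff, forall_and, uniformAmp, weight₁, Finset.prod_const,
      Finset.card_univ, Fintype.card_fin]
    by_cases h1 : ∀ v, x v 1 = 0 <;> by_cases h2 : ∀ v, x v 2 = 0 <;>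
      by_cases h4 : ∀ v, x v 4 = 0 <;> simp [h1, h2, h4]
  · intro y _ hy
    rw [Pi.single_eq_of_ne hy, mul_zero]
  · exact fun h => (h (Finset.mem_univ _)).elim

/-- The state left by the first run is regrouped as the start of the second: its sum condition
becomes a weight, and the weight's condition on qudit `4` becomes the blank target. -/
theorem sumAmp_weight₁ : sumAmp 0 1 2 (weight₁ k n) = uniformAmp 1 4 (weight₂ k n) := by
  funext y
  simp only [sumAmp, uniformAmp, weight₁, weight₂]
  by_cases h1 : ∀ v, y v 1 = 0 <;> by_cases h2 : ∀ v, y v 2 = sumMod k n fun w => y w 0 <;>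
      by_cases h4 : ∀ v, y v 4 = 0 <;> simp [h1, h2, h4]

/-- The Fourier transform of the uniform superposition of the vectors with a given sum. -/
theorem sum_fourier_mul_sumIndicator (z : Fin n → ZMod k) (s : ZMod k) :
    ∑ a : Fin n → ZMod k, (∏ v, fourier k (z v) (a v)) * (if s = sumMod k n a then 1 else 0) =
      ((Real.sqrt k : ℝ) : ℂ) ^ n * (k : ℂ)⁻¹ *
        ∑ p, if ∀ v, z v = p then (ZMod.stdAddChar (p * s) : ℂ) else 0 := by
  have hk : (k : ℂ) ≠ 0 := NeZero.ne _
  -- The indicator of the sum is expanded in additive characters, which factor over the parties.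
  have h1 : ∀ a : Fin n → ZMod k, (if s = sumMod k n a then (1 : ℂ) else 0) =
      (k : ℂ)⁻¹ * ∑ p : ZMod k, ZMod.stdAddChar (p * s) * ∏ v, ZMod.stdAddChar (-p * a v) := by
    intro a
    have h2 : ∀ p : ZMod k, (ZMod.stdAddChar (p * s) : ℂ) * ∏ v, ZMod.stdAddChar (-p * a v) =
        ZMod.stdAddChar (p * (s - sumMod k n a)) := by
      intro p
      have h7 : ∏ v, (ZMod.stdAddChar (-p * a v) : ℂ) = ZMod.stdAddChar (∑ v, -p * a v) :=
        (stdAddChar_sum _).symm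
      rw [h7, ← AddChar.map_add_eq_mul, ← Finset.mul_sum, sumMod]
      congr 1
      ring
    simp only [h2, sum_stdAddChar_mul, sub_eq_zero]
    split_ifs
    · rw [inv_mul_cancel₀ hk]
    · rw [mul_zero]
  -- For fixed `p`, orthogonality at each party separately forces `z v = p`.
  have h3 : ∀ p : ZMod k, ∑ a : Fin n → ZMod k, ∏ v,
      (fourier k (z v) (a v) * ZMod.stdAddChar (-p * a v)) =
        if ∀ v, z v = p then ((Real.sqrt k : ℝ) : ℂ) ^ n else 0 := by
    intro p
    have h4 : ∀ v, ∑ b : ZMod k, fourier k (z v) b * ZMod.stdAddChar (-p * b) =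
        if z v = p then ((Real.sqrt k : ℝ) : ℂ) else 0 := by
      intro v
      have h5 : ∀ b, fourier k (z v) b * ZMod.stdAddChar (-p * b) =
          ZMod.stdAddChar (b * (z v - p)) * ((Real.sqrt k : ℝ) : ℂ)⁻¹ := by
        intro b
        have : b * (z v - p) = z v * b + -p * b := by ring
        rw [this, AddChar.map_add_eq_mul, fourier, Matrix.of_apply]
        ring
      simp only [h5, ← Finset.sum_mul, sum_stdAddChar_mul, sub_eq_zero]
      split_ifs
      · rw [← sqrt_mul_sqrt, mul_assoc, mul_inv_cancel₀ (sqrt_ne_zero k), mul_one]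
      · rw [zero_mul]
    have h6 : ∑ a : Fin n → ZMod k, ∏ v, (fourier k (z v) (a v) * ZMod.stdAddChar (-p * a v)) =
        ∏ v, ∑ b : ZMod k, fourier k (z v) b * ZMod.stdAddChar (-p * b) := by
      rw [Finset.prod_univ_sum, Fintype.piFinset_univ]
    rw [h6]
    simp only [h4, Finset.prod_ite_zero, Finset.mem_univ, true_imp_iff, Finset.prod_const,
      Finset.card_univ, Fintype.card_fin]
  calc _ = ∑ a : Fin n → ZMod k, ∑ p : ZMod k, (k : ℂ)⁻¹ * ZMod.stdAddChar (p * s) *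
        ∏ v, (fourier k (z v) (a v) * ZMod.stdAddChar (-p * a v)) := by
        refine Finset.sum_congr rfl fun a _ => ?_
        rw [h1, Finset.mul_sum, Finset.mul_sum]
        refine Finset.sum_congr rfl fun p _ => ?_
        rw [Finset.prod_mul_distrib]
        ring
    _ = _ := by
        rw [Finset.sum_comm, Finset.mul_sum]
        refine Finset.sum_congr rfl fun p _ => ?_
        rw [← Finset.mul_sum, h3]
        split_ifs
        · ring
        · ring

theorem sum_fourier_mul (v₀ : Fin n) (z s : Fin n → ZMod k) :
    ∑ a : Fin n → ZMod k, (∏ v, fourier k (z v) (a v)) *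
        (if ∀ v, s v = sumMod k n a then 1 else 0) =
      ((Real.sqrt k : ℝ) : ℂ) ^ n * (k : ℂ)⁻¹ *
        if (∀ v, z v = z v₀) ∧ ∀ v, s v = s v₀ then
          (ZMod.stdAddChar (z v₀ * s v₀) : ℂ) else 0 := by
  by_cases hs : ∀ v, s v = s v₀
  · have h : ∀ a, (∀ v, s v = sumMod k n a) ↔ s v₀ = sumMod k n a :=
      fun a => ⟨fun h => h v₀, fun h v => (hs v).trans h⟩
    simp only [h]
    rw [sum_fourier_mul_sumIndicator, Finset.sum_eq_single (z v₀)]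
    · simp [hs]
    · intro p _ hp
      exact if_neg fun h => hp (h v₀).symm
    · exact fun h => (h (Finset.mem_univ _)).elim
  · rw [if_neg fun h => hs h.2, mul_zero]
    refine Finset.sum_eq_zero fun a _ => ?_
    rw [if_neg fun h => hs fun v => (h v).trans (h v₀).symm, mul_zero]

/-- The amplitudes of the superposition of common values after the second Fourier transform. -/
def pairAmp (k : ℕ) [NeZero k] : (Fin 5 → ZMod k) → ℂ :=
  fun p => if p 1 = 0 then
    ZMod.stdAddChar (p 0 * p 2 + p 3 * p 4) * ((k : ℂ) ^ 2)⁻¹ else 0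

/-- The values `x` with the qudits `0` and `3` replaced by `a` and `b`. -/
def setInputs (x : Fin n → Fin 5 → ZMod k) (ab : (Fin n → ZMod k) × (Fin n → ZMod k)) :
    Fin n → Fin 5 → ZMod k :=
  fun v => ![ab.1 v, x v 1, x v 2, ab.2 v, x v 4]

theorem setInputs_injective (x : Fin n → Fin 5 → ZMod k) : Function.Injective (setInputs x) :=
  fun _ _ h => Prod.ext (funext fun v => congrFun (congrFun h v) 0)
    (funext fun v => congrFun (congrFun h v) 3)

theorem prod_fourierGate_eq_zero (x y : Fin n → Fin 5 → ZMod k)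
    (hy : y ∉ Set.range (setInputs x)) : ∏ v, fourierGate k (x v) (y v) = 0 := by
  have : ∃ v, ¬ (y v 1 = x v 1 ∧ y v 2 = x v 2 ∧ y v 4 = x v 4) := by
    by_contra! h
    refine hy ⟨(fun v => y v 0, fun v => y v 3), funext fun v => funext fun i => ?_⟩
    fin_cases i
    · rfl
    · exact (h v).1.symm
    · exact (h v).2.1.symm
    · rfl
    · exact (h v).2.2.symm
  obtain ⟨v, hv⟩ := this
  refine Finset.prod_eq_zero (Finset.mem_univ v) ?_
  rw [fourierGate_apply, if_neg hv]

theorem prod_fourierGate_setInputs (x : Fin n → Fin 5 → ZMod k)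
    (ab : (Fin n → ZMod k) × (Fin n → ZMod k)) :
    ∏ v, fourierGate k (x v) (setInputs x ab v) =
      (∏ v, fourier k (x v 0) (ab.1 v)) * ∏ v, fourier k (x v 3) (ab.2 v) := by
  rw [← Finset.prod_mul_distrib]
  refine Finset.prod_congr rfl fun v _ => ?_
  rw [fourierGate_apply, if_pos ⟨rfl, rfl, rfl⟩]
  rfl

theorem sumAmp_setInputs (x : Fin n → Fin 5 → ZMod k)
    (ab : (Fin n → ZMod k) × (Fin n → ZMod k)) :
    sumAmp 3 1 4 (weight₂ k n) (setInputs x ab) =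
      (if ∀ v, x v 1 = 0 then ((k : ℂ)⁻¹) ^ n else 0) *
        ((if ∀ v, x v 2 = sumMod k n ab.1 then 1 else 0) *
          (if ∀ v, x v 4 = sumMod k n ab.2 then 1 else 0)) := by
  have h : sumAmp 3 1 4 (weight₂ k n) (setInputs x ab) =
      if (∀ v, x v 1 = 0) ∧ ∀ v, x v 4 = sumMod k n ab.2 then
        (if ∀ v, x v 2 = sumMod k n ab.1 then ((k : ℂ)⁻¹) ^ n else 0) else 0 := rfl
  rw [h]
  by_cases ha : ∀ v, x v 1 = 0 <;> by_cases hb : ∀ v, x v 4 = sumMod k n ab.2 <;>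
    by_cases hd : ∀ v, x v 2 = sumMod k n ab.1 <;> simp [ha, hb, hd]

/-- The two inputs and their sums do not interact, so the transform is a product of two independent
ones. -/
theorem sum_fourierGate_mul_sumAmp (x : Fin n → Fin 5 → ZMod k) :
    ∑ y, (∏ v, fourierGate k (x v) (y v)) * sumAmp 3 1 4 (weight₂ k n) y =
      (if ∀ v, x v 1 = 0 then ((k : ℂ)⁻¹) ^ n else 0) *
        ((∑ a : Fin n → ZMod k, (∏ v, fourier k (x v 0) (a v)) *
          (if ∀ v, x v 2 = sumMod k n a then 1 else 0)) *
        ∑ a : Fin n → ZMod k, (∏ v, fourier k (x v 3) (a v)) *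
          (if ∀ v, x v 4 = sumMod k n a then 1 else 0)) := by
  have h1 : ∑ ab, (∏ v, fourierGate k (x v) (setInputs x ab v)) *
      sumAmp 3 1 4 (weight₂ k n) (setInputs x ab) =
      ∑ y, (∏ v, fourierGate k (x v) (y v)) * sumAmp 3 1 4 (weight₂ k n) y :=
    Fintype.sum_of_injective (setInputs x) (setInputs_injective x) _ _
      (fun y hy => mul_eq_zero_of_left (prod_fourierGate_eq_zero x y hy) _) fun _ => rfl
  rw [← h1, Finset.sum_mul_sum, Finset.mul_sum, Fintype.sum_prod_type]
  refine Finset.sum_congr rfl fun a _ => ?_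
  rw [Finset.mul_sum]
  refine Finset.sum_congr rfl fun b _ => ?_
  rw [prod_fourierGate_setInputs, sumAmp_setInputs]
  ring

theorem fourierGate_sumAmp (v₀ : Fin n) :
    (fun x : Fin n → Fin 5 → ZMod k => ∑ y, (∏ v, fourierGate k (x v) (y v)) *
      sumAmp 3 1 4 (weight₂ k n) y) = constAmp v₀ (pairAmp k) := by
  funext x
  have hk : (k : ℂ) ≠ 0 := NeZero.ne _
  rw [sum_fourierGate_mul_sumAmp, sum_fourier_mul v₀ (fun v => x v 0) fun v => x v 2,
    sum_fourier_mul v₀ (fun v => x v 3) fun v => x v 4]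
  have h5 : (∀ v, x v = x v₀) ↔ (∀ v, x v 1 = x v₀ 1) ∧
      ((∀ v, x v 0 = x v₀ 0) ∧ ∀ v, x v 2 = x v₀ 2) ∧
      ((∀ v, x v 3 = x v₀ 3) ∧ ∀ v, x v 4 = x v₀ 4) := by
    simp only [← forall_and]
    refine forall_congr' fun v => ⟨fun h => by simp [h], fun h => funext fun i => ?_⟩
    fin_cases i
    · exact h.2.1.1
    · exact h.1
    · exact h.2.1.2
    · exact h.2.2.1
    · exact h.2.2.2
  -- The normalisation `k⁻ⁿ` of the inputs cancels the two factors `(√k)ⁿ`, leaving `k⁻¹` from each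
  -- transform.
  have h6 : ((k : ℂ)⁻¹) ^ n * (((Real.sqrt k : ℝ) : ℂ) ^ n * ((Real.sqrt k : ℝ) : ℂ) ^ n) = 1 := by
    rw [← mul_pow, ← mul_pow, sqrt_mul_sqrt, inv_mul_cancel₀ hk, one_pow]
  simp only [constAmp, h5, pairAmp]
  by_cases ha : ∀ v, x v 1 = 0
  · have ha' : ∀ v, x v 1 = x v₀ 1 := fun v => (ha v).trans (ha v₀).symm
    by_cases hb : (∀ v, x v 0 = x v₀ 0) ∧ ∀ v, x v 2 = x v₀ 2
    · by_cases hd : (∀ v, x v 3 = x v₀ 3) ∧ ∀ v, x v 4 = x v₀ 4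
      · rw [if_pos ha, if_pos hb, if_pos hd, if_pos ⟨ha', hb, hd⟩, if_pos (ha v₀),
          AddChar.map_add_eq_mul, pow_two, mul_inv]
        linear_combination ((k : ℂ)⁻¹ * (k : ℂ)⁻¹ * ZMod.stdAddChar (x v₀ 0 * x v₀ 2) *
          ZMod.stdAddChar (x v₀ 3 * x v₀ 4)) * h6
      · rw [if_pos ha, if_neg hd, if_pos hb, if_neg (mt (fun h => h.2.2) hd)]
        ring
    · rw [if_neg hb, mul_zero, zero_mul, mul_zero]
      exact (if_neg fun h => hb h.2.1).symm
  · rw [if_neg ha, zero_mul]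
    symm
    by_cases h0 : x v₀ 1 = 0
    · exact if_neg fun h => ha fun v => (h.1 v).trans h0
    · rw [if_neg h0, ite_self]

/-- Since every party applies the same bijection, equal values stay equal. -/
theorem constAmp_comp (v₀ : Fin n) (σ : Equiv.Perm (Fin 5 → ZMod k)) (β : (Fin 5 → ZMod k) → ℂ)
    (y : Fin n → Fin 5 → ZMod k) :
    constAmp v₀ β (fun v => σ (y v)) = constAmp v₀ (fun p => β (σ p)) y := by
  simp only [constAmp, σ.injective.eq_iff]

end amplitudes

/-! ### The output state -/

section output
variable {F : UnitaryAlgorithm k} {n : ℕ} {N : Network n}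

/-- The configuration in which all parties hold the values `p`. -/
def constConfig (F : UnitaryAlgorithm k) (N : Network n) (p : Fin 5 → ZMod k) : Config F 5 N :=
  fun v => (p, F.work0 (N.deg v))

theorem sum_eq_sum_constConfig (v₀ : Fin n) (β : (Fin 5 → ZMod k) → ℂ) (G : Config F 5 N → ℂ)
    (h : ∀ c, clean F N (constAmp v₀ β) c = 0 → G c = 0) :
    ∑ c, G c = ∑ p, G (constConfig F N p) := by
  symm
  refine Fintype.sum_of_injective (constConfig F N)
    (fun p p' h => congrArg Prod.fst (congrFun h v₀)) _ _ (fun c hc => h c ?_) fun _ => rfl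
  rw [clean]
  split_ifs with h1
  · exact if_neg fun h2 => hc ⟨(c v₀).1, funext fun v => Prod.ext (h2 v).symm (h1 v).symm⟩
  · rfl

theorem clean_constConfig (v₀ : Fin n) (β : (Fin 5 → ZMod k) → ℂ) (p : Fin 5 → ZMod k) :
    clean F N (constAmp v₀ β) (constConfig F N p) = β p := by
  simp [clean, constAmp, constConfig]

theorem ghz_apply (v₀ : Fin n) (z : Fin n → ZMod k) :
    ghz k n z = if ∀ v, z v = z v₀ then ((Real.sqrt k : ℝ) : ℂ)⁻¹ else 0 := by
  rw [ghz, Finset.sum_eq_single (z v₀)]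
  · rw [Finset.prod_ite_zero]
    simp only [Finset.mem_univ, true_imp_iff, Finset.prod_const_one]
    split_ifs
    · rw [one_div]
    · rw [zero_div]
  · intro b _ hb
    exact Finset.prod_eq_zero (Finset.mem_univ v₀) (if_neg (Ne.symm hb))
  · exact fun h => (h (Finset.mem_univ _)).elim

/-- By `hβ` the common value of qudit `0` has no influence on the amplitude, so qudit `0` is in a
product state with the rest and coherence survives the partial trace. -/
theorem reduced_clean_constAmp (v₀ : Fin n) (β : (Fin 5 → ZMod k) → ℂ)
    (hβ : ∀ p p', (∀ i, i ≠ 0 → p i = p' i) → β p = β p')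
    (hnorm : ∀ p, β p * star (β p) = if p 1 = 0 then ((k : ℂ) ^ 4)⁻¹ else 0) :
    reduced (0 : Fin 5) (Matrix.vecMulVec (clean F N (constAmp v₀ β))
      (star (clean F N (constAmp v₀ β)))) = Matrix.vecMulVec (ghz k n) (star (ghz k n)) := by
  classical
  have hk : (k : ℂ) ≠ 0 := NeZero.ne _
  ext z z'
  rw [reduced, Matrix.of_apply]
  simp only [Matrix.vecMulVec_apply, Pi.star_apply]
  rw [sum_eq_sum_constConfig v₀ β]
  swap
  · intro c hc
    simp [hc]
  have inner : ∀ p, (∑ c', if ∀ v, (constConfig F N p v).1 0 = z v ∧ (c' v).1 0 = z' v ∧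
      (∀ j, j ≠ 0 → (constConfig F N p v).1 j = (c' v).1 j) ∧ (constConfig F N p v).2 = (c' v).2
      then clean F N (constAmp v₀ β) (constConfig F N p) * star (clean F N (constAmp v₀ β) c')
      else 0) = if (∀ v, p 0 = z v) ∧ (∀ v, z' v = z' v₀) ∧ p 1 = 0 then ((k : ℂ) ^ 4)⁻¹ else 0 := by
    intro p
    rw [sum_eq_sum_constConfig v₀ β]
    swap
    · intro c hc
      simp [hc]
    simp only [clean_constConfig]
    -- The partial trace forces the two common values to agree except in qudit `0`.
    rw [Finset.sum_eq_single (Function.update p 0 (z' v₀))]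
    · have hu : ∀ i, i ≠ 0 → p i = Function.update p 0 (z' v₀) i :=
        fun i hi => (Function.update_of_ne hi _ _).symm
      rw [← hβ p _ hu, hnorm]
      have : (∀ v, (constConfig F N p v).1 0 = z v ∧
          (constConfig F N (Function.update p 0 (z' v₀)) v).1 0 = z' v ∧
          (∀ j, j ≠ 0 → (constConfig F N p v).1 j =
            (constConfig F N (Function.update p 0 (z' v₀)) v).1 j) ∧
          (constConfig F N p v).2 = (constConfig F N (Function.update p 0 (z' v₀)) v).2) ↔
          (∀ v, p 0 = z v) ∧ ∀ v, z' v = z' v₀ := by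
        rw [← forall_and]
        refine forall_congr' fun v => ⟨fun h => ⟨h.1, h.2.1.symm.trans ?_⟩,
          fun h => ⟨h.1, Eq.trans ?_ h.2.symm, hu, rfl⟩⟩
        · exact Function.update_self 0 (z' v₀) p
        · exact Function.update_self 0 (z' v₀) p
      simp only [this]
      by_cases h1 : ∀ v, p 0 = z v <;> by_cases h2 : ∀ v, z' v = z' v₀ <;>
        by_cases h3 : p 1 = 0 <;> simp [h1, h2, h3]
    · intro p' _ hp'
      refine if_neg fun h => hp' ?_
      funext i
      by_cases hi : i = 0
      · subst hi
        rw [Function.update_self]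
        exact (h v₀).2.1
      · rw [Function.update_of_ne hi]
        exact ((h v₀).2.2.1 i hi).symm
    · exact fun h => (h (Finset.mem_univ _)).elim
  -- Three qudits remain free, which gives `k ^ 3` terms of weight `k⁻⁴`.
  have count : ∀ a : ZMod k, ∑ p : Fin 5 → ZMod k,
      (if p 0 = a ∧ p 1 = 0 then ((k : ℂ) ^ 4)⁻¹ else 0) = (k : ℂ)⁻¹ := by
    intro a
    let g : Fin 5 → ZMod k → ℂ :=
      ![fun b => if b = a then 1 else 0, fun b => if b = 0 then 1 else 0, 1, 1, 1]
    have hg : ∀ p : Fin 5 → ZMod k, (if p 0 = a ∧ p 1 = 0 then ((k : ℂ) ^ 4)⁻¹ else 0) =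
        ((k : ℂ) ^ 4)⁻¹ * ∏ i, g i (p i) := by
      intro p
      have : ∏ i, g i (p i) = (if p 0 = a then 1 else 0) * (if p 1 = 0 then 1 else 0) * 1 * 1 * 1 :=
        Fin.prod_univ_five _
      rw [this]
      by_cases h0 : p 0 = a <;> by_cases h1 : p 1 = 0 <;> simp [h0, h1]
    have hprod : ∑ p : Fin 5 → ZMod k, ∏ i, g i (p i) = (k : ℂ) ^ 3 := by
      rw [← Fintype.piFinset_univ, ← Finset.prod_univ_sum, Fin.prod_univ_five]
      simp [g, ZMod.card]
      ring
    simp only [hg]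
    rw [← Finset.mul_sum, hprod]
    field_simp
  refine (Finset.sum_congr rfl fun p _ => inner p).trans ?_
  rw [ghz_apply v₀, ghz_apply v₀]
  have hs : star ((Real.sqrt k : ℝ) : ℂ)⁻¹ = ((Real.sqrt k : ℝ) : ℂ)⁻¹ := by simp
  by_cases h1 : ∀ v, z v = z v₀
  · by_cases h2 : ∀ v, z' v = z' v₀
    · rw [if_pos h1, if_pos h2, hs, ← mul_inv, sqrt_mul_sqrt, ← count (z v₀)]
      refine Finset.sum_congr rfl fun p _ => ?_
      have : (∀ v, p 0 = z v) ↔ p 0 = z v₀ := ⟨fun h => h v₀, fun h v => h.trans (h1 v).symm⟩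
      simp only [this, h2, implies_true, true_and]
    · rw [if_neg h2, star_zero, mul_zero]
      exact Finset.sum_eq_zero fun p _ => if_neg fun h => h2 h.2.1
  · rw [if_neg h1, zero_mul]
    exact Finset.sum_eq_zero fun p _ => if_neg fun h => h1 fun v => (h.1 v).symm.trans (h.1 v₀)

end output

/-! ### The program -/

/-- The gate set, for a permutation `σ` of the basis states of five qudits. -/
abbrev ghzGates (σ : Equiv.Perm (Fin 5 → ZMod k)) : GateSet k where
  size := 4
  arity _ := 5
  gate := ![⟨fourierGate k, fourierGate_mem⟩,
    ⟨permGate (subtractPerm 1 2 (by decide)), permGate_mem _⟩,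
    ⟨permGate (subtractPerm 1 4 (by decide)), permGate_mem _⟩, ⟨permGate σ, permGate_mem _⟩]

/-- Input qudit `0` and output qudit `1`. -/
def firstPair : Fin 2 ↪ Fin 5 := ⟨![0, 1], by decide⟩

/-- Input qudit `3` and output qudit `1`. -/
def secondPair : Fin 2 ↪ Fin 5 := ⟨![3, 1], by decide⟩

/-- The program: two independent sums of uniformly random inputs are computed into qudits `2` and
`4`; the Fourier transform of the inputs is a pair of GHZ states with known phases, which are then
combined so that one of the two states has no phase. -/
abbrev ghzProgram (σ : Equiv.Perm (Fin 5 → ZMod k)) : Program (ghzGates σ) where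
  qudits := 5
  code := [.gate (0 : Fin 4) (Function.Embedding.refl (Fin 5)), .call firstPair,
    .gate (1 : Fin 4) (Function.Embedding.refl (Fin 5)), .uncall firstPair, .call secondPair,
    .gate (2 : Fin 4) (Function.Embedding.refl (Fin 5)), .uncall secondPair,
    .gate (0 : Fin 4) (Function.Embedding.refl (Fin 5)),
    .gate (3 : Fin 4) (Function.Embedding.refl (Fin 5))]
  out := 0

/-- The actions of the program. -/
def ghzActions (σ : Equiv.Perm (Fin 5 → ZMod k)) (F : UnitaryAlgorithm k) : List (Action F 5) :=
  [gateAction F (fourierGate k)] ++ (F.actions firstPair ++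
    ([gateAction F (permGate (subtractPerm 1 2 (by decide)))] ++
    ((F.actions firstPair).reverse.map Action.inverse ++ (F.actions secondPair ++
    ([gateAction F (permGate (subtractPerm 1 4 (by decide)))] ++
    ((F.actions secondPair).reverse.map Action.inverse ++
    [gateAction F (fourierGate k), gateAction F (permGate σ)]))))))

theorem ghzProgram_actions (σ : Equiv.Perm (Fin 5 → ZMod k)) (F : UnitaryAlgorithm k) :
    (ghzProgram σ).actions F = ghzActions σ F := by
  simp only [Program.actions, ghzProgram, List.flatMap_cons, List.flatMap_nil, List.append_nil]
  rfl

theorem isPure_actions {q : ℕ} (F : UnitaryAlgorithm k) (e : Fin 2 ↪ Fin q) :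
    ∀ a ∈ F.actions e, a.IsPure := by
  intro a ha
  rw [actions_eq_map_embed] at ha
  obtain ⟨b, hb, rfl⟩ := List.mem_map.1 ha
  have := (isUnitary_ownActions F b hb).isPure
  cases b <;> exact this

theorem isPure_inverse_actions {q : ℕ} (F : UnitaryAlgorithm k) (e : Fin 2 ↪ Fin q) :
    ∀ a ∈ (F.actions e).reverse.map Action.inverse, a.IsPure := by
  intro a ha
  obtain ⟨b, hb, rfl⟩ := List.mem_map.1 ha
  have := isPure_actions F e b (List.mem_reverse.1 hb)
  cases b <;> exact this

theorem isPure_ghzActions (σ : Equiv.Perm (Fin 5 → ZMod k)) (F : UnitaryAlgorithm k) :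
    ∀ a ∈ ghzActions σ F, a.IsPure := by
  have hg : ∀ M, (gateAction F (q := 5) M).IsPure := fun _ => trivial
  simp only [ghzActions, List.forall_mem_append, List.forall_mem_cons, hg, true_and, List.not_mem_nil,
    false_imp_iff, implies_true, and_true]
  exact ⟨isPure_actions F _, isPure_inverse_actions F _, isPure_actions F _,
    isPure_inverse_actions F _⟩

theorem ghzProgram_rounds (σ : Equiv.Perm (Fin 5 → ZMod k)) (F : UnitaryAlgorithm k) :
    (ghzProgram σ).rounds F = 4 * F.Qrnd := by
  rw [Program.rounds, ghzProgram_actions]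
  simp only [ghzActions, numRounds_append, numRounds_actions, numRounds_inverse_actions, gateAction, numRounds]
  ring

section run
variable {F : UnitaryAlgorithm k} {n : ℕ} {N : Network n}

theorem initState_ghzProgram (σ : Equiv.Perm (Fin 5 → ZMod k)) :
    (ghzProgram σ).initState F N =
      Matrix.vecMulVec (clean F N (Pi.single 0 1 : (Fin n → Fin 5 → ZMod k) → ℂ))
        (star (clean F N (Pi.single 0 1))) := by
  classical
  have h : clean F N (Pi.single 0 1 : (Fin n → Fin 5 → ZMod k) → ℂ) =
      Pi.single (fun v => (0, F.work0 (N.deg v))) 1 := by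
    funext c
    have : c = (fun v => (0, F.work0 (N.deg v))) ↔
        (∀ v, (c v).2 = F.work0 (N.deg v)) ∧ (fun v => (c v).1) = 0 :=
      ⟨by rintro rfl; exact ⟨fun _ => rfl, rfl⟩,
        fun h => funext fun v => Prod.ext (congrFun h.2 v) (h.1 v)⟩
    rw [clean, Pi.single_apply, Pi.single_apply]
    simp only [this]
    by_cases h1 : ∀ v, (c v).2 = F.work0 (N.deg v) <;> simp [h1]
  rw [h]
  ext c c'
  simp only [Program.initState, Matrix.vecMulVec_apply, Pi.star_apply, Matrix.single_apply,
    Pi.single_apply, ghzProgram]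
  by_cases h1 : c = (fun v => (0, F.work0 (N.deg v))) <;>
    by_cases h2 : c' = (fun v => (0, F.work0 (N.deg v))) <;> simp [h1, h2, eq_comm]

theorem independentOf_weight₁ : IndependentOf firstPair 2 (weight₁ k n) := by
  intro y y' h
  have : ∀ v, y v 4 = y' v 4 := fun v => h v 4 (by decide) (by decide) (by decide)
  simp only [weight₁, this]

theorem independentOf_weight₂ : IndependentOf secondPair 4 (weight₂ k n) := by
  intro y y' h
  have h2 : ∀ v, y v 2 = y' v 2 := fun v => h v 2 (by decide) (by decide) (by decide)
  have h0 : ∀ v, y v 0 = y' v 0 := fun v => h v 0 (by decide) (by decide) (by decide)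
  simp only [weight₂, h2, h0]

theorem two_not_mem_firstPair : (2 : Fin 5) ∉ Set.range firstPair := by
  rintro ⟨i, hi⟩
  revert i
  decide

theorem four_not_mem_secondPair : (4 : Fin 5) ∉ Set.range secondPair := by
  rintro ⟨i, hi⟩
  revert i
  decide

theorem toLin_fourierGate_init :
    (gateAction F (fourierGate k)).toLin N (clean F N (Pi.single 0 1)) =
      clean F N (uniformAmp (firstPair 1) 2 (weight₁ k n)) := by
  rw [gateAction_toLin_clean, fourierGate_single_zero]
  rfl

theorem toLin_subtractPerm {i j : Fin 5} (h : i ≠ j) (ψ : Config F 5 N → ℂ) :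
    (gateAction F (permGate (subtractPerm i j h))).toLin N ψ = subtractVec i j ψ :=
  permGate_toLin _ _

theorem evolve_first (hF : F.Computes N (sumMod k n)) (v₀ : Fin n) :
    evolve N ((F.actions firstPair).reverse.map Action.inverse) (subtractVec 1 2
      (evolve N (F.actions firstPair) (clean F N (uniformAmp (firstPair 1) 2 (weight₁ k n))))) =
      clean F N (uniformAmp (secondPair 1) 4 (weight₂ k n)) :=
  (evolve_uncall hF two_not_mem_firstPair independentOf_weight₁ v₀).trans
    (congrArg (clean F N) sumAmp_weight₁)

theorem evolve_second (hF : F.Computes N (sumMod k n)) (v₀ : Fin n) :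
    evolve N ((F.actions secondPair).reverse.map Action.inverse) (subtractVec 1 4
      (evolve N (F.actions secondPair) (clean F N (uniformAmp (secondPair 1) 4 (weight₂ k n))))) =
      clean F N (sumAmp 3 1 4 (weight₂ k n)) :=
  evolve_uncall hF four_not_mem_secondPair independentOf_weight₂ v₀

theorem evolve_ghzActions (σ : Equiv.Perm (Fin 5 → ZMod k)) (hF : F.Computes N (sumMod k n))
    (v₀ : Fin n) :
    evolve N (ghzActions σ F) (clean F N (Pi.single 0 1)) =
      clean F N (constAmp v₀ fun p => pairAmp k (σ p)) := by
  have h1 : ∀ (a : Action F 5) (ψ : Config F 5 N → ℂ), evolve N [a] ψ = a.toLin N ψ :=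
    fun _ _ => rfl
  have h2 : ∀ (a b : Action F 5) (ψ : Config F 5 N → ℂ),
    evolve N [a, b] ψ = b.toLin N (a.toLin N ψ) := fun _ _ _ => rfl
  rw [ghzActions, evolve_append, h1, toLin_fourierGate_init, evolve_append, evolve_append,
    h1, toLin_subtractPerm, evolve_append, evolve_first hF v₀, evolve_append, evolve_append, h1,
    toLin_subtractPerm, evolve_append, evolve_second hF v₀, h2, gateAction_toLin_clean,
    fourierGate_sumAmp v₀, permGate_toLin]
  funext c
  change (if _ then constAmp v₀ (pairAmp k) (fun v => σ (c v).1) else 0) = _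
  rw [constAmp_comp]
  rfl

theorem pureBits_ghzActions_le (σ : Equiv.Perm (Fin 5 → ZMod k))
    (hF : F.Computes N (sumMod k n)) (v₀ : Fin n) :
    pureBits N (ghzActions σ F) (clean F N (Pi.single 0 1)) ≤
      (2 * (k + 1)) * F.Qbit N := by
  have h1 : ∀ M (ψ : Config F 5 N → ℂ), evolve N [gateAction F M] ψ = (gateAction F M).toLin N ψ :=
    fun _ _ => rfl
  have h2 : ∀ M (ψ : Config F 5 N → ℂ), pureBits N [gateAction F M] ψ = 0 := fun _ _ => rfl
  have h3 : ∀ M M' (ψ : Config F 5 N → ℂ),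
    pureBits N [gateAction F M, gateAction F M'] ψ = 0 := fun _ _ _ => rfl
  rw [ghzActions, pureBits_append, h1, h2, toLin_fourierGate_init, pureBits_append,
    pureBits_append, h1, h2, toLin_subtractPerm, pureBits_append, evolve_first hF v₀,
    pureBits_append, pureBits_append, h1, h2, toLin_subtractPerm, pureBits_append, h3]
  have b1 := pureBits_call (F := F) (N := N) two_not_mem_firstPair (independentOf_weight₁ (k := k))
  have b2 := pureBits_uncall hF two_not_mem_firstPair independentOf_weight₁ v₀
  have b3 := pureBits_call (F := F) (N := N) four_not_mem_secondPair
    (independentOf_weight₂ (k := k))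
  have b4 := pureBits_uncall hF four_not_mem_secondPair independentOf_weight₂ v₀
  calc _ ≤ 0 + (F.Qbit N + (0 + (k * F.Qbit N + (F.Qbit N + (0 + (k * F.Qbit N + 0)))))) := by
        gcongr
        exacts [b2, b4]
    _ = _ := by ring

end run

end AnonQ

end

theorem theorem3 (k : ℕ) [NeZero k] (hk : 2 ≤ k) :
    ∃ (S : AnonQ.GateSet k) (P : AnonQ.Program S) (C : ℕ),
      ∀ (n : ℕ) (F : AnonQ.UnitaryAlgorithm k) (N : AnonQ.Network n),
        F.Computes N (AnonQ.sumMod k n) →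
          P.SharesGHZ F N ∧ P.rounds F ≤ C * F.Qrnd ∧ P.bits F N ≤ C * F.Qbit N := by
  obtain ⟨σ, g, hσ⟩ := AnonQ.exists_perm_linear_form k
  -- Each of the two sums costs `Qbit` forwards and at most `k * Qbit` backwards; the same constant
  -- covers the four runs, since `4 ≤ 2 * (k + 1)`.
  refine ⟨AnonQ.ghzGates σ, AnonQ.ghzProgram σ, 2 * (k + 1), fun n F N hF => ?_⟩
  obtain ⟨v₀⟩ := N.connected.nonempty
  have hβ : ∀ p, AnonQ.pairAmp k (σ p) =
      if p 1 = 0 then ZMod.stdAddChar (g (p 2) (p 4) * p 3) * ((k : ℂ) ^ 2)⁻¹ else 0 := by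
    intro p
    simp only [AnonQ.pairAmp, (hσ p).1, (hσ p).2]
  refine ⟨?_, ?_, ?_⟩
  · rw [AnonQ.Program.SharesGHZ, AnonQ.ghzProgram_actions, AnonQ.initState_ghzProgram,
      AnonQ.run_vecMulVec (AnonQ.isPure_ghzActions σ F), AnonQ.evolve_ghzActions σ hF v₀]
    refine AnonQ.reduced_clean_constAmp v₀ _ (fun p p' h => ?_) fun p => ?_
    -- After `σ` the phase involves qudits `2`, `3` and `4` only.
    · rw [hβ, hβ, h 1 (by decide), h 2 (by decide), h 3 (by decide), h 4 (by decide)]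
    · rw [hβ]
      split_ifs
      · have h1 : star ((k : ℂ) ^ 2)⁻¹ = ((k : ℂ) ^ 2)⁻¹ := by simp
        have h2 : ∀ a : ZMod k, (ZMod.stdAddChar a : ℂ) * ZMod.stdAddChar (-a) = 1 := fun a => by
          rw [← AddChar.map_add_eq_mul, add_neg_cancel, AddChar.map_zero_eq_one]
        rw [star_mul', h1, AnonQ.conj_stdAddChar, mul_mul_mul_comm, h2, one_mul, ← mul_inv,
          ← pow_add]
      · simp
  · rw [AnonQ.ghzProgram_rounds]
    exact Nat.mul_le_mul_right _ (by omega)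
  · rw [AnonQ.Program.bits, AnonQ.ghzProgram_actions, AnonQ.initState_ghzProgram,
      AnonQ.numBits_vecMulVec (AnonQ.isPure_ghzActions σ F)]
    exact AnonQ.pureBits_ghzActions_le σ hF v₀
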